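/- **Model.** Let $L>1$ be the number of cells, $K$ the number of single-antenna users per cell, $M\ge K\ge 1$ the number of antennas of a base station (BS), and $\tau$ the number of pilot symbols. Fix a cell $\ell$ and its BS. For $i\in\{1,\dots,L\}$ let $G_i=H_iD_i^{1/2}$ be the $M\times K$ channel matrix from the users of cell $i$ to this BS, where $D_i=\mathrm{diag}(\beta_{i,1},\dots,\beta_{i,K})$ with $\beta_{i,k}>0$, and let $N\in\mathbb C^{M\times\tau}$ and $n\in\mathbb C^{M}$ be the noises of the pilot and the data phase; all entries of $H_1,\dots,H_L,N,n$ are independent $\mathcal{CN}(0,1)$ random variables. Let $P>0$ be the transmit power and $\Psi\in\mathbb C^{\tau\times K}$ with $\Psi^\dagger\Psi=I_K$ the pilot matrix, which all cells share. The BS receives $Y=\sqrt{\tau P}\sum_iG_i\Psi^{T}+N$ and estimates the $k$-th column of $G_i$ by $\frac{\sqrt{\tau P}\,\beta_{i,k}}{\tau P\sum_j\beta_{j,k}+1}$ times the $k$-th column of $Y\Psi^{*}$; call the estimate $\hat G_i$, and put $\xi_i=G_i-\hat G_i$, $\hat G=\hat G_\ell$. The data vectors $x_i\in\mathbb C^K$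 are square integrable with $\mathbb E[x_ix_i^\dagger]=I_K$, and they are (jointly) independent of $(H_1,\dots,H_L,N,n)$. Let $a_k$ be the $k$-th column of the zero-forcing receiver $A=\hat G(\hat G^\dagger\hat G)^{-1}$. The SINR of user $k$ of cell $\ell$ is $$\gamma=\Bigl(\mathbb E\bigl[|a_k^\dagger\xi_\ell x_\ell|^2\,\big|\,\hat G\bigr]+\mathbb E\Bigl[\sum_{i\ne\ell}|a_k^\dagger G_ix_i|^2\,\Big|\,\hat G\Bigr]+\mathbb E\bigl[|a_k^\dagger n|^2/P\,\big|\,\hat G\bigr]\Bigr)^{-1}.$$ Put $$\alpha_i=\sum_{k=1}^K\frac{\beta_{i,k}\bigl(\tau P\sum_{j\ne i}\beta_{j,k}+1\bigr)}{\tau P\sum_{j}\beta_{j,k}+1},\quad \theta=\sum_{i=1}^L\alpha_i+\frac1P,\quad \eta=\frac{\sum_{i\neq\ell}\beta_{i,k}^2}{\beta_{\ell,k}^2},\quad \hat\beta_k=\sum_{i}\beta_{i,k}+\frac1{\tau P},\quad \tilde\theta=\frac{\hat\beta_k}{\beta_{\ell,k}^2}\,\theta .$$ **Proposition.** For every user $k$: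 1. $\hat G_i=\mathbb E[G_i\mid Y]$ almost surely for every $i$ (so $\hat G_i$ is the MMSE estimate), and $\mathbb E[\xi_i\xi_i^\dagger]=\alpha_iI_M$. 2. With $X=1/\bigl[(\hat G^\dagger\hat G)^{-1}\bigr]_{kk}$, almost surely $X>0$ and $\gamma=\dfrac{X}{\theta+\eta X}$. 3. $\gamma$ has the density $$p(s)=\frac{\tilde\theta^{\,M-K+1}}{(M-K)!}\,\frac{s^{M-K}}{(1-\eta s)^{M-K+2}}\exp\Bigl(-\frac{\tilde\theta s}{1-\eta s}\Bigr)\quad\text{for }0<s<\frac1\eta,$$ and $p(s)=0$ otherwise. 4. $\Pr(\gamma\le s)=1-\exp\bigl(-\frac{\tilde\theta s}{1-\eta s}\bigr)\sum_{i=0}^{M-K}\frac1{i!}\bigl(\frac{\tilde\theta s}{1-\eta s}\bigr)^i$ for $0\le s<1/\eta$; it is $0$ for $s<0$ and $1$ for $s\ge1/\eta$. -/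

import Mathlib

open MeasureTheory ProbabilityTheory
open scoped ENNReal Matrix Nat

noncomputable section

namespace MassiveMIMO

/-- The standard circularly symmetric complex Gaussian law `CN(0, 1)`: the real and the imaginary
part are independent real Gaussians with mean `0` and variance `1 / 2`. -/
def stdComplexGaussian : Measure ℂ :=
  ((gaussianReal 0 (1 / 2)).prod (gaussianReal 0 (1 / 2))).map (fun p : ℝ × ℝ => (⟨p.1, p.2⟩ : ℂ))

/-- Deterministic parameters of the uplink seen from one fixed base station, the one of cell `ℓ`:
`L` cells, `M` antennas, `K` users per cell, `τ` pilot symbols. `β i k` is the large-scale fading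
coefficient from user `k` of cell `i` to this base station, `P` is the transmit power, and the
columns of `Ψ` are the orthonormal pilots, which are reused in all cells. -/
structure Params (L M K τ : ℕ) where
  /-- the cell whose base station is considered -/
  ℓ : Fin L
  /-- the average transmit power of each user -/
  P : ℝ
  /-- the large-scale fading coefficients towards the base station of cell `ℓ` -/
  β : Fin L → Fin K → ℝ
  /-- the pilot matrix -/
  Ψ : Matrix (Fin τ) (Fin K) ℂ
  P_pos : 0 < P
  β_pos : ∀ i k, 0 < β i k
  pilot_orthonormal : Ψᴴ * Ψ = 1

/-- The random quantities of the uplink: fast-fading channel matrices `H i` from the users of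
cell `i` to the base station, pilot-phase noise `N`, data-phase noise `n` and transmitted symbol
vectors `x i`. -/
structure Signals (L M K τ : ℕ) {Ω : Type*} [MeasurableSpace Ω] (μ : Measure Ω) where
  /-- fast fading -/
  H : Fin L → Ω → Matrix (Fin M) (Fin K) ℂ
  /-- noise while the pilots are received -/
  N : Ω → Matrix (Fin M) (Fin τ) ℂ
  /-- noise while the data are received -/
  n : Ω → Fin M → ℂ
  /-- data symbols -/
  x : Fin L → Ω → Fin K → ℂ
  measurable_H : ∀ i m k, Measurable fun ω => H i ω m k
  measurable_N : ∀ m t, Measurable fun ω => N ω m t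
  measurable_n : ∀ m, Measurable fun ω => n ω m
  measurable_x : ∀ i k, Measurable fun ω => x i ω k
  law_H : ∀ i m k, μ.map (fun ω => H i ω m k) = stdComplexGaussian
  law_N : ∀ m t, μ.map (fun ω => N ω m t) = stdComplexGaussian
  law_n : ∀ m, μ.map (fun ω => n ω m) = stdComplexGaussian
  /-- all fading coefficients and all noise samples are mutually independent -/
  indep_gaussian :
    iIndepFun (fun (j : ((Fin L × Fin M × Fin K) ⊕ (Fin M × Fin τ)) ⊕ Fin M) (ω : Ω) =>
      match j with
      | .inl (.inl (i, m, k)) => H i ω m k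
      | .inl (.inr (m, t)) => N ω m t
      | .inr m => n ω m) μ
  /-- the data are independent of all fading coefficients and of all noise samples -/
  indep_data :
    IndepFun (fun ω i k => x i ω k)
      (fun ω => ((fun i m k => H i ω m k, fun m t => N ω m t, n ω) :
        (Fin L → Fin M → Fin K → ℂ) × (Fin M → Fin τ → ℂ) × (Fin M → ℂ))) μ
  memLp_x : ∀ i k, MemLp (fun ω => x i ω k) 2 μ
  /-- `E[x_i x_i†] = I` -/
  covariance_x : ∀ i k k',
    ∫ ω, x i ω k * star (x i ω k') ∂μ = if k = k' then 1 else 0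

variable {L M K τ : ℕ}

namespace Params

variable (p : Params L M K τ)

/-- `β̂_k = ∑ i, β i k + 1 / (τ P)`. -/
def βhat (k : Fin K) : ℝ := ∑ i, p.β i k + 1 / (τ * p.P)

/-- The power `α_i` of the channel estimation error for cell `i`, summed over the users: the
variance of a single entry of the `k`-th error column is
`β i k * (τ P ∑_{j ≠ i} β j k + 1) / (τ P ∑ j, β j k + 1)`. -/
def α (i : Fin L) : ℝ :=
  ∑ k, p.β i k * (τ * p.P * ∑ j ∈ Finset.univ.erase i, p.β j k + 1) /
    (τ * p.P * ∑ j, p.β j k + 1)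

/-- `θ = ∑ i, α_i + 1 / P`. -/
def θ : ℝ := ∑ i, p.α i + 1 / p.P

/-- `η = ∑_{i ≠ ℓ} β i k ^ 2 / β ℓ k ^ 2`. -/
def η (k : Fin K) : ℝ := (∑ i ∈ Finset.univ.erase p.ℓ, p.β i k ^ 2) / p.β p.ℓ k ^ 2

/-- `θ` in units of the scale `β ℓ k ^ 2 / β̂_k` of the estimated channel of user `k`. -/
def θnorm (k : Fin K) : ℝ := p.θ * p.βhat k / p.β p.ℓ k ^ 2

/-- The claimed density of the SINR of user `k`. -/
def sinrPDF (k : Fin K) (s : ℝ) : ℝ :=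
  if 0 < s ∧ s < 1 / p.η k then
    p.θnorm k ^ (M - K + 1) / ((M - K)! : ℝ) * (s ^ (M - K) / (1 - p.η k * s) ^ (M - K + 2)) *
      Real.exp (-(p.θnorm k * s / (1 - p.η k * s)))
  else 0

/-- The claimed cumulative distribution function of the SINR of user `k`. -/
def sinrCDF (k : Fin K) (s : ℝ) : ℝ :=
  if s < 0 then 0
  else if s < 1 / p.η k then
    1 - Real.exp (-(p.θnorm k * s / (1 - p.η k * s))) *
      ∑ i ∈ Finset.range (M - K + 1), (p.θnorm k * s / (1 - p.η k * s)) ^ i / (i ! : ℝ)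
  else 1

end Params

namespace Signals

variable {Ω : Type*} [MeasurableSpace Ω] {μ : Measure Ω}
variable (S : Signals L M K τ μ) (p : Params L M K τ)

/-- The channel matrix `G_i = H_i D_i^{1/2}`. -/
def G (i : Fin L) (ω : Ω) : Matrix (Fin M) (Fin K) ℂ :=
  S.H i ω * Matrix.diagonal fun k => (Real.sqrt (p.β i k) : ℂ)

/-- The received pilot matrix `Y = √(τ P) ∑ i, G_i Ψᵀ + N`. -/
def pilotY (ω : Ω) : Matrix (Fin M) (Fin τ) ℂ :=
  (Real.sqrt (τ * p.P) : ℂ) • (∑ i, S.G p i ω * p.Ψᵀ) + S.N ω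

/-- The received pilots after projection on the conjugated pilot matrix. -/
def pilotProj (ω : Ω) : Matrix (Fin M) (Fin K) ℂ :=
  S.pilotY p ω * p.Ψ.map star

/-- The MMSE estimate of the channel matrix `G_i`, whose `k`-th column is
`√(τ P) β i k / (τ P ∑ j, β j k + 1)` times the `k`-th column of the projected pilots. -/
def Ghat (i : Fin L) (ω : Ω) : Matrix (Fin M) (Fin K) ℂ :=
  S.pilotProj p ω * Matrix.diagonal fun k =>
    ((Real.sqrt (τ * p.P) * p.β i k / (τ * p.P * ∑ j, p.β j k + 1) : ℝ) : ℂ)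

/-- The channel estimation error `ξ_i = G_i - Ĝ_i`. -/
def ξ (i : Fin L) (ω : Ω) : Matrix (Fin M) (Fin K) ℂ := S.G p i ω - S.Ghat p i ω

/-- The zero-forcing receiver `A = Ĝ (Ĝ† Ĝ)⁻¹` built from the estimate `Ĝ = Ĝ_ℓ`. -/
def A (ω : Ω) : Matrix (Fin M) (Fin K) ℂ :=
  S.Ghat p p.ℓ ω * ((S.Ghat p p.ℓ ω)ᴴ * S.Ghat p p.ℓ ω)⁻¹

/-- `a_k† v` for the `k`-th column `a_k` of the zero-forcing receiver. -/
def detect (k : Fin K) (ω : Ω) (v : Fin M → ℂ) : ℂ := ((S.A p ω)ᴴ *ᵥ v) k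

/-- The σ-algebra generated by the received pilots. -/
abbrev pilotSigma : MeasurableSpace Ω :=
  MeasurableSpace.comap (fun (ω : Ω) (m : Fin M) (t : Fin τ) => S.pilotY p ω m t) inferInstance

/-- The σ-algebra generated by the channel estimate `Ĝ_ℓ`. -/
abbrev estimateSigma : MeasurableSpace Ω :=
  MeasurableSpace.comap (fun (ω : Ω) (m : Fin M) (k : Fin K) => S.Ghat p p.ℓ ω m k) inferInstance

/-- The uplink SINR of user `k` of cell `ℓ` after zero forcing,
`(E|a_k† ξ_ℓ x_ℓ|² + E ∑_{i ≠ ℓ} |a_k† G_i x_i|² + E[|a_k† n|² / P])⁻¹`, where the expectations are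
conditional on the channel estimate `Ĝ_ℓ`, so that the SINR is a random variable. (Conditional
expectations of `[0, ∞]`-valued functions: for `M = K` the three terms are not integrable.) -/
def sinr (k : Fin K) (ω : Ω) : ℝ :=
  ((condLExp (S.estimateSigma p) μ
        (fun ω => ‖S.detect p k ω (S.ξ p p.ℓ ω *ᵥ S.x p.ℓ ω)‖ₑ ^ 2) ω
      + condLExp (S.estimateSigma p) μ
        (fun ω => ∑ i ∈ Finset.univ.erase p.ℓ, ‖S.detect p k ω (S.G p i ω *ᵥ S.x i ω)‖ₑ ^ 2) ω
      + condLExp (S.estimateSigma p) μ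
        (fun ω => ‖S.detect p k ω (S.n ω)‖ₑ ^ 2 / ENNReal.ofReal p.P) ω)⁻¹).toReal

/-- `X = 1 / [(Ĝ† Ĝ)⁻¹]_kk` (the diagonal entry is real, as the matrix is Hermitian). -/
def X (k : Fin K) (ω : Ω) : ℝ :=
  1 / ((((S.Ghat p p.ℓ ω)ᴴ * S.Ghat p p.ℓ ω)⁻¹) k k).re

end Signals

end MassiveMIMO

end

noncomputable section

/-! ### Linear forms in independent complex Gaussian variables -/

namespace MassiveMIMO

/-! Channels, pilots, estimates and errors all have entries that are linear forms `c ⬝ᵥ Z` in one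
vector `Z` of independent CN(0, 1) variables. The characteristic function of such a form depends on
`c` only through `c ⬝ᵥ star c`. Hence uncorrelated families of forms are independent
(`indepFun_dotProduct`) and orthonormal families are again standard Gaussian (`hasLaw_dotProduct`),
so that the probabilistic claims about estimation become identities between coefficient vectors. The
gain of the estimator solves the normal equation `cov_ξ_Y`; therefore ξ_i is centred and independent
of Y, which is the MMSE property, and its covariance is read off from `cov_ξ_ξ`.

Since all cells reuse the same pilots, the estimates differ only by column scalings
(`Ghat_eq_mul_diagonal`): G_i = ξ_i + Ĝ diag(β_i / β_ℓ). Zero forcing inverts Ĝ, so cell i ≠ ℓ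
leaves the residue (β_{i,k} / β_{ℓ,k}) x_{i,k} + a_k† ξ_i x_i, while the error term of cell ℓ has
only the second part. The pair (ξ_i, x_i) is independent of Ĝ, so conditioning on Ĝ means averaging
with Ĝ frozen; the mean power is the squared first coefficient plus α_i ‖a_k‖²
(`lintegral_zfOutput`). The noise adds ‖a_k‖² / P. As ‖a_k‖² = 1 / X, summation gives 1 / γ = η + θ
/ X (`ae_sinr_eq`).

Geometrically, X is the squared distance of the k-th column of Ĝ from the span of the other K - 1
columns (`one_div_gram_inv`). With those columns frozen, the coordinates of the k-th one in an
orthonormal basis of their complement are M - K + 1 independent Gaussians of equal variance. So X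
divided by this variance has an Erlang law that does not depend on the frozen columns
(`hasLaw_one_div_gram_inv`, `hasLaw_X_div`). The density of γ follows by a change of variables
(`map_erlangMeasure_sinr`), and its distribution function because γ is increasing in X. -/

lemma measurable_complexMk : Measurable fun p : ℝ × ℝ => (⟨p.1, p.2⟩ : ℂ) := by
  have : (fun p : ℝ × ℝ => (⟨p.1, p.2⟩ : ℂ)) = fun p => (p.1 : ℂ) + p.2 * Complex.I := by
    ext p
    apply Complex.ext <;> simp
  rw [this]
  fun_prop

instance : IsProbabilityMeasure stdComplexGaussian := by
  unfold stdComplexGaussian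
  exact Measure.isProbabilityMeasure_map measurable_complexMk.aemeasurable

/-- The law of a finite family of independent `CN(0, 1)` random variables. -/
abbrev gaussVec (ι : Type*) [Fintype ι] : Measure (ι → ℂ) :=
  Measure.pi fun _ : ι => stdComplexGaussian

/-- For z = x + iy, Re(tz) splits into a form in x and one in y, and each of these independent N(0,
1/2) variables contributes a square over 4. -/
lemma integral_exp_re_stdComplexGaussian (t : ℂ) :
    ∫ z, Complex.exp ((t * z).re * Complex.I) ∂stdComplexGaussian
      = Complex.exp (-(‖t‖ ^ 2 / 4 : ℝ)) := by
  rw [stdComplexGaussian, integral_map measurable_complexMk.aemeasurable]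
  swap
  · fun_prop
  have h1 : ∀ p : ℝ × ℝ, Complex.exp (((t * (⟨p.1, p.2⟩ : ℂ)).re : ℂ) * Complex.I)
      = Complex.exp (t.re * p.1 * Complex.I) * Complex.exp ((-t.im : ℝ) * p.2 * Complex.I) := by
    intro p
    rw [← Complex.exp_add]
    congr 1
    simp only [Complex.mul_re]
    push_cast
    ring
  simp_rw [h1]
  rw [integral_prod_mul (f := fun x : ℝ => Complex.exp (t.re * x * Complex.I))
    (g := fun x : ℝ => Complex.exp ((-t.im : ℝ) * x * Complex.I))]
  rw [← charFun_apply_real, ← charFun_apply_real, charFun_gaussianReal, charFun_gaussianReal,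
    ← Complex.exp_add]
  congr 1
  rw [← Complex.normSq_eq_norm_sq, Complex.normSq_apply]
  push_cast
  simp
  ring

/-- Every real linear functional on `ℂ^ι` is the real part of a complex linear one. -/
lemma exists_eq_re_dotProduct {ι : Type*} [Fintype ι] (l : (ι → ℂ) →L[ℝ] ℝ) :
    ∃ t : ι → ℂ, ∀ v, l v = (t ⬝ᵥ v).re := by
  classical
  -- The minus sign compensates the one in Re(tz) = Re t Re z - Im t Im z.
  refine ⟨fun i => ⟨l (Pi.single i 1), - l (Pi.single i Complex.I)⟩, fun v => ?_⟩
  have hv : v = ∑ i, ((v i).re • (Pi.single i 1 : ι → ℂ)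
      + (v i).im • (Pi.single i Complex.I : ι → ℂ)) := by
    ext j
    simp [Finset.sum_apply, Pi.single_apply, Finset.sum_add_distrib, Complex.re_add_im]
  conv_lhs => rw [hv]
  simp only [map_sum, map_add, map_smul, dotProduct, Complex.re_sum, Complex.mul_re, smul_eq_mul]
  refine Finset.sum_congr rfl fun i _ => ?_
  ring

section Linear

variable {J ι κ Ω : Type*} [Fintype J] [Fintype ι] [Fintype κ] [MeasurableSpace Ω]
  {μ : Measure Ω} {Z : Ω → J → ℂ}

/-- Only the Hermitian square of `c` survives on the right; this is why covariances alone decide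
laws and independence below. -/
lemma integral_exp_re_dotProduct (hZ : HasLaw Z (gaussVec J) μ) (c : J → ℂ) :
    ∫ ω, Complex.exp ((c ⬝ᵥ Z ω).re * Complex.I) ∂μ
      = Complex.exp (-((c ⬝ᵥ star c).re / 4 : ℝ)) := by
  have h0 := hZ.integral_comp (f := fun z : J → ℂ => Complex.exp ((c ⬝ᵥ z).re * Complex.I))
    (by
      have : Measurable fun z : J → ℂ => Complex.exp ((c ⬝ᵥ z).re * Complex.I) := by
        unfold dotProduct
        fun_prop
      exact this.aestronglyMeasurable)
  simp only [Function.comp_def] at h0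
  rw [h0]
  have h1 : ∀ z : J → ℂ, Complex.exp ((c ⬝ᵥ z).re * Complex.I)
      = ∏ j, Complex.exp ((c j * z j).re * Complex.I) := by
    intro z
    rw [← Complex.exp_sum, ← Finset.sum_mul, dotProduct, Complex.re_sum]
    push_cast
    rfl
  simp_rw [h1]
  rw [integral_fintype_prod_eq_prod
    (f := fun j (z : ℂ) => Complex.exp ((c j * z).re * Complex.I))]
  simp_rw [integral_exp_re_stdComplexGaussian]
  rw [← Complex.exp_sum]
  congr 1
  simp only [dotProduct, Complex.re_sum, Pi.star_apply, RCLike.star_def, Complex.mul_conj,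
    Complex.ofReal_re, Complex.normSq_eq_norm_sq]
  rw [Finset.sum_div]
  push_cast
  rw [Finset.sum_neg_distrib]

lemma dotProduct_sum_smul (a : ι → J → ℂ) (t : ι → ℂ) (z : J → ℂ) :
    t ⬝ᵥ (fun i => a i ⬝ᵥ z) = (∑ i, t i • a i) ⬝ᵥ z := by
  rw [sum_dotProduct]
  simp [dotProduct, Finset.mul_sum, mul_assoc]

omit [Fintype ι] in
lemma aemeasurable_dotProduct (hZ : HasLaw Z (gaussVec J) μ) (a : ι → J → ℂ) :
    AEMeasurable (fun ω i => a i ⬝ᵥ Z ω) μ := by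
  have h : Measurable fun (z : J → ℂ) i => a i ⬝ᵥ z := by
    unfold dotProduct
    fun_prop
  exact h.comp_aemeasurable hZ.aemeasurable

lemma charFunDual_map_dotProduct (hZ : HasLaw Z (gaussVec J) μ) (a : ι → J → ℂ)
    {l : (ι → ℂ) →L[ℝ] ℝ} {t : ι → ℂ} (ht : ∀ v, l v = (t ⬝ᵥ v).re) :
    charFunDual (μ.map fun ω i => a i ⬝ᵥ Z ω) l
      = Complex.exp (-(((∑ i, t i • a i) ⬝ᵥ star (∑ i, t i • a i)).re / 4 : ℝ)) := by
  rw [charFunDual_apply, integral_map (aemeasurable_dotProduct hZ a) (by fun_prop)]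
  simp_rw [ht, dotProduct_sum_smul]
  exact integral_exp_re_dotProduct hZ _

/-- Uncorrelated families of linear combinations of independent `CN(0, 1)` variables are
independent. -/
theorem indepFun_dotProduct [IsProbabilityMeasure μ] (hZ : HasLaw Z (gaussVec J) μ)
    (a : ι → J → ℂ) (b : κ → J → ℂ) (h : ∀ i k, a i ⬝ᵥ star (b k) = 0) :
    IndepFun (fun ω i => a i ⬝ᵥ Z ω) (fun ω k => b k ⬝ᵥ Z ω) μ := by
  rw [indepFun_iff_charFunDual_prod (aemeasurable_dotProduct hZ a) (aemeasurable_dotProduct hZ b)]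
  intro l
  obtain ⟨t, ht⟩ := exists_eq_re_dotProduct (l.comp (.inl ℝ (ι → ℂ) (κ → ℂ)))
  obtain ⟨s, hs⟩ := exists_eq_re_dotProduct (l.comp (.inr ℝ (ι → ℂ) (κ → ℂ)))
  rw [charFunDual_map_dotProduct hZ a ht, charFunDual_map_dotProduct hZ b hs, charFunDual_apply,
    integral_map ((aemeasurable_dotProduct hZ a).prodMk (aemeasurable_dotProduct hZ b))
      (by fun_prop), ← Complex.exp_add]
  have hl : ∀ x y, l (x, y) = (t ⬝ᵥ x).re + (s ⬝ᵥ y).re := by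
    intro x y
    rw [← ht, ← hs, ContinuousLinearMap.comp_apply, ContinuousLinearMap.comp_apply, ← map_add]
    simp
  simp_rw [hl, dotProduct_sum_smul, ← Complex.add_re, ← add_dotProduct]
  rw [integral_exp_re_dotProduct hZ]
  congr 1
  -- Joint and product characteristic functions differ only by the cross terms of the Hermitian
  -- square, which vanish for uncorrelated families.
  have h0 : (∑ i, t i • a i) ⬝ᵥ star (∑ k, s k • b k) = 0 := by
    simp [star_sum, sum_dotProduct, dotProduct_sum, h]
  have h0' : (∑ k, s k • b k) ⬝ᵥ star (∑ i, t i • a i) = 0 := by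
    rw [Matrix.dotProduct_star, h0, star_zero]
  rw [star_add, add_dotProduct, dotProduct_add, dotProduct_add, h0, h0']
  push_cast
  simp
  ring

/-- Orthonormal linear combinations of independent `CN(0, 1)` variables are again independent
`CN(0, 1)` variables. -/
theorem hasLaw_dotProduct [IsProbabilityMeasure μ] [DecidableEq ι]
    (hZ : HasLaw Z (gaussVec J) μ)
    (a : ι → J → ℂ) (h : ∀ i i', a i ⬝ᵥ star (a i') = if i = i' then 1 else 0) :
    HasLaw (fun ω i => a i ⬝ᵥ Z ω) (gaussVec ι) μ := by
  have hm := aemeasurable_dotProduct hZ a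
  refine ⟨hm, ?_⟩
  have := Measure.isProbabilityMeasure_map (μ := μ) hm
  refine Measure.ext_of_charFunDual (funext fun l => ?_)
  obtain ⟨t, ht⟩ := exists_eq_re_dotProduct l
  rw [charFunDual_map_dotProduct hZ a ht, charFunDual_apply]
  simp_rw [ht]
  -- The target law is treated as the law of the identity map, so both sides are given by the same
  -- formula.
  refine Eq.trans ?_ (integral_exp_re_dotProduct (HasLaw.id (μ := gaussVec ι)) t).symm
  have h1 : (∑ i, t i • a i) ⬝ᵥ star (∑ i, t i • a i) = t ⬝ᵥ star t := by
    simp only [star_sum, star_smul, sum_dotProduct, dotProduct_sum, smul_dotProduct,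
      dotProduct_smul, h]
    simp [dotProduct, mul_comm]
  rw [h1]

end Linear

end MassiveMIMO

/-! ### Second moments, and conditioning by freezing an independent variable -/

namespace MassiveMIMO

lemma memLp_stdComplexGaussian : MemLp (fun z : ℂ => z) 2 stdComplexGaussian := by
  rw [stdComplexGaussian, memLp_map_measure_iff (by fun_prop) measurable_complexMk.aemeasurable]
  have h : ((fun z : ℂ => z) ∘ fun p : ℝ × ℝ => (⟨p.1, p.2⟩ : ℂ))
      = fun p => (p.1 : ℂ) + p.2 * Complex.I := by
    ext p
    apply Complex.ext <;> simp
  rw [h]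
  have h0 : MemLp (fun x : ℝ => x) 2 (gaussianReal 0 (1 / 2)) :=
    memLp_id_gaussianReal' 2 (by simp)
  have h1 := h0.comp_measurePreserving
    (measurePreserving_fst (μ := gaussianReal 0 (1 / 2)) (ν := gaussianReal 0 (1 / 2)))
  have h2 := h0.comp_measurePreserving
    (measurePreserving_snd (μ := gaussianReal 0 (1 / 2)) (ν := gaussianReal 0 (1 / 2)))
  have h3 : MemLp (fun p : ℝ × ℝ => (p.1 : ℂ))
    2 ((gaussianReal 0 (1 / 2)).prod (gaussianReal 0 (1 / 2))) := h1.ofReal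
  have h4 : MemLp (fun p : ℝ × ℝ => (p.2 : ℂ))
    2 ((gaussianReal 0 (1 / 2)).prod (gaussianReal 0 (1 / 2))) := h2.ofReal
  exact h3.add (h4.mul_const _)

lemma integral_stdComplexGaussian : ∫ z, z ∂stdComplexGaussian = 0 := by
  have hodd : stdComplexGaussian.map (fun z => -z) = stdComplexGaussian := by
    have h1 : (gaussianReal 0 (1 / 2)).map (fun x => -x) = gaussianReal 0 (1 / 2) := by
      rw [gaussianReal_map_neg, neg_zero]
    unfold stdComplexGaussian
    rw [Measure.map_map (by fun_prop) measurable_complexMk]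
    conv_rhs => rw [← h1, Measure.map_prod_map _ _ measurable_neg measurable_neg,
      Measure.map_map measurable_complexMk (by fun_prop)]
    congr 1
  have h2 : ∫ z, z ∂stdComplexGaussian = - ∫ z, z ∂stdComplexGaussian := by
    conv_lhs => rw [← hodd]
    rw [integral_map (by fun_prop) (by fun_prop), integral_neg]
  linear_combination (1 / 2) * h2

lemma integral_sq_gaussianReal_half : ∫ x, x ^ 2 ∂(gaussianReal 0 (1 / 2)) = 1 / 2 := by
  have h := variance_of_integral_eq_zero (μ := gaussianReal 0 (1 / 2)) (X := fun x => x)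
    (by fun_prop) (by simp)
  simp only [variance_fun_id_gaussianReal] at h
  simpa using h.symm

lemma integral_mul_star_stdComplexGaussian : ∫ z, z * star z ∂stdComplexGaussian = 1 := by
  rw [stdComplexGaussian, integral_map measurable_complexMk.aemeasurable (by fun_prop)]
  have h : ∀ p : ℝ × ℝ, (⟨p.1, p.2⟩ : ℂ) * star (⟨p.1, p.2⟩ : ℂ)
      = ((p.1 ^ 2 + p.2 ^ 2 : ℝ) : ℂ) := by
    intro p
    rw [RCLike.star_def, Complex.mul_conj, Complex.normSq_apply]
    simp [sq]
  simp_rw [h]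
  rw [integral_complex_ofReal]
  have h0 : Integrable (fun x : ℝ => x ^ 2) (gaussianReal 0 (1 / 2)) :=
    MemLp.integrable_sq (memLp_id_gaussianReal' 2 (by simp))
  rw [integral_add (h0.comp_fst _) (h0.comp_snd _), integral_fun_fst (fun x : ℝ => x ^ 2),
    integral_fun_snd (fun x : ℝ => x ^ 2), integral_sq_gaussianReal_half]
  norm_num

section Orthonormal

variable {ι Ω : Type*} [Fintype ι] [MeasurableSpace Ω] {μ : Measure Ω} {U : ι → Ω → ℂ}

lemma memLp_dotProduct (hU : ∀ i, MemLp (U i) 2 μ) (a : ι → ℂ) :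
    MemLp (fun ω => a ⬝ᵥ fun i => U i ω) 2 μ := by
  unfold dotProduct
  exact memLp_finsetSum _ fun i _ => (hU i).const_mul (a i)

/-- Only second moments enter, so this serves the data symbols, which need not be Gaussian, as well
as the Gaussian vector. -/
lemma integral_dotProduct_mul_star [DecidableEq ι] (hU : ∀ i, MemLp (U i) 2 μ)
    (hO : ∀ i j, ∫ ω, U i ω * star (U j ω) ∂μ = if i = j then 1 else 0) (a b : ι → ℂ) :
    ∫ ω, (a ⬝ᵥ fun i => U i ω) * star (b ⬝ᵥ fun i => U i ω) ∂μ = a ⬝ᵥ star b := by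
  have h1 : ∀ ω, (a ⬝ᵥ fun i => U i ω) * star (b ⬝ᵥ fun i => U i ω)
      = ∑ i, ∑ j, (a i * star (b j)) * (U i ω * star (U j ω)) := by
    intro ω
    simp only [dotProduct, star_sum, Finset.sum_mul_sum, star_mul']
    refine Finset.sum_congr rfl fun i _ => Finset.sum_congr rfl fun j _ => ?_
    ring
  have hi : ∀ i j, Integrable (fun ω => (a i * star (b j)) * (U i ω * star (U j ω))) μ :=
    fun i j => ((hU i).integrable_mul (hU j).star).const_mul _
  simp_rw [h1]
  rw [integral_finsetSum _ fun i _ => integrable_finsetSum _ fun j _ => hi i j]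
  simp_rw [integral_finsetSum _ fun j _ => hi _ j, integral_const_mul, hO]
  simp [dotProduct]

lemma lintegral_enorm_dotProduct_sq [DecidableEq ι] (hU : ∀ i, MemLp (U i) 2 μ)
    (hO : ∀ i j, ∫ ω, U i ω * star (U j ω) ∂μ = if i = j then 1 else 0) (a : ι → ℂ) :
    ∫⁻ ω, ‖a ⬝ᵥ fun i => U i ω‖ₑ ^ 2 ∂μ = ENNReal.ofReal (∑ i, ‖a i‖ ^ 2) := by
  have hL := memLp_dotProduct hU a
  have h1 : ∀ ω, ‖a ⬝ᵥ fun i => U i ω‖ₑ ^ 2 = ENNReal.ofReal (‖a ⬝ᵥ fun i => U i ω‖ ^ 2) := by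
    intro ω
    rw [← ofReal_norm, ENNReal.ofReal_pow (norm_nonneg _)]
  simp_rw [h1]
  rw [← ofReal_integral_eq_lintegral_ofReal hL.norm.integrable_sq
    (Filter.Eventually.of_forall fun ω => by positivity)]
  congr 1
  apply Complex.ofReal_injective
  rw [← integral_complex_ofReal]
  have h2 : ∀ z : ℂ, ((‖z‖ ^ 2 : ℝ) : ℂ) = z * star z := by
    intro z
    rw [RCLike.star_def, Complex.mul_conj, Complex.normSq_eq_norm_sq]
  simp_rw [h2]
  rw [integral_dotProduct_mul_star hU hO]
  push_cast
  simp only [dotProduct, Pi.star_apply, ← h2]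
  push_cast
  rfl

end Orthonormal

section Moments

variable {J Ω : Type*} [Fintype J] [MeasurableSpace Ω]
  {μ : Measure Ω} {Z : Ω → J → ℂ}

lemma hasLaw_eval_gaussVec (hZ : HasLaw Z (gaussVec J) μ) (j : J) :
    HasLaw (fun ω => Z ω j) stdComplexGaussian μ :=
  (measurePreserving_eval (fun _ : J => stdComplexGaussian) j).fun_comp_hasLaw hZ

lemma iIndepFun_of_hasLaw_gaussVec [IsProbabilityMeasure μ] (hZ : HasLaw Z (gaussVec J) μ) :
    iIndepFun (fun j ω => Z ω j) μ :=
  (iIndepFun_iff_hasLaw_pi_pi fun j => hasLaw_eval_gaussVec hZ j).2 hZ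

lemma memLp_of_hasLaw_gaussVec (hZ : HasLaw Z (gaussVec J) μ) (j : J) :
    MemLp (fun ω => Z ω j) 2 μ := by
  have h := hasLaw_eval_gaussVec hZ j
  have h2 := memLp_stdComplexGaussian
  rw [← h.map_eq, memLp_map_measure_iff (by fun_prop) h.aemeasurable] at h2
  exact h2

lemma integral_of_hasLaw_gaussVec (hZ : HasLaw Z (gaussVec J) μ) (j : J) :
    ∫ ω, Z ω j ∂μ = 0 := by
  rw [(hasLaw_eval_gaussVec hZ j).integral_eq, integral_stdComplexGaussian]

lemma integral_mul_star_of_hasLaw_gaussVec [IsProbabilityMeasure μ] [DecidableEq J]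
    (hZ : HasLaw Z (gaussVec J) μ) (i j : J) :
    ∫ ω, Z ω i * star (Z ω j) ∂μ = if i = j then 1 else 0 := by
  split_ifs with h
  · subst h
    have := (hasLaw_eval_gaussVec hZ i).integral_comp (f := fun z : ℂ => z * star z)
      (by fun_prop)
    simpa only [Function.comp_def, integral_mul_star_stdComplexGaussian] using this
  · have hI := ((iIndepFun_of_hasLaw_gaussVec hZ).indepFun h).comp
      (measurable_id : Measurable fun z : ℂ => z)
      (continuous_star.measurable : Measurable fun z : ℂ => star z)
    have := hI.integral_mul_eq_mul_integral
      (hasLaw_eval_gaussVec hZ i).aemeasurable.aestronglyMeasurable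
      (memLp_of_hasLaw_gaussVec hZ j).star.aestronglyMeasurable
    simp only [Pi.mul_def, Function.comp_def, id, integral_of_hasLaw_gaussVec hZ i, zero_mul] at this
    exact this

lemma integral_dotProduct_of_hasLaw (hZ : HasLaw Z (gaussVec J) μ) [IsProbabilityMeasure μ]
    (a : J → ℂ) : ∫ ω, a ⬝ᵥ Z ω ∂μ = 0 := by
  unfold dotProduct
  rw [integral_finsetSum _ fun j _ =>
    ((memLp_of_hasLaw_gaussVec hZ j).integrable (by norm_num)).const_mul _]
  simp [integral_const_mul, integral_of_hasLaw_gaussVec hZ]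

/-- The constant 1 is orthogonal to the centred variables; adjoined to them as the `none` entry of
an `Option` family, it leaves the family orthonormal. -/
lemma lintegral_enorm_const_add_dotProduct_sq [IsProbabilityMeasure μ]
    (hZ : HasLaw Z (gaussVec J) μ) (c : ℂ) (a : J → ℂ) :
    ∫⁻ ω, ‖c + a ⬝ᵥ Z ω‖ₑ ^ 2 ∂μ = ENNReal.ofReal (‖c‖ ^ 2 + ∑ j, ‖a j‖ ^ 2) := by
  classical
  have h := lintegral_enorm_dotProduct_sq (μ := μ) (ι := Option J)
    (U := fun o ω => o.elim 1 (Z ω)) (a := fun o => o.elim c a) ?_ ?_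
  · simpa [dotProduct, Fintype.sum_option] using h
  · rintro (_ | j)
    · exact memLp_const 1
    · exact memLp_of_hasLaw_gaussVec hZ j
  · rintro (_ | i) (_ | j)
    · simp
    · have := integral_of_hasLaw_gaussVec hZ j
      simpa [integral_conj] using this
    · simpa using integral_of_hasLaw_gaussVec hZ i
    · simpa using integral_mul_star_of_hasLaw_gaussVec hZ i j

end Moments

section CondLExp

variable {Ω 𝓤 𝓥 𝓦 : Type*} [MeasurableSpace Ω] [MeasurableSpace 𝓤] [MeasurableSpace 𝓥]
  [MeasurableSpace 𝓦] {μ : Measure Ω} [IsProbabilityMeasure μ]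

/-- Fubini for the product law of the pair, transported back to Ω so that `V` can be frozen at an
outcome. -/
lemma lintegral_of_indepFun {V : Ω → 𝓥} {U : Ω → 𝓤} (hV : Measurable V) (hU : AEMeasurable U μ)
    (h : IndepFun V U μ) {F : 𝓥 × 𝓤 → ℝ≥0∞} (hF : Measurable F) :
    ∫⁻ ω, F (V ω, U ω) ∂μ = ∫⁻ ω, ∫⁻ ω', F (V ω, U ω') ∂μ ∂μ := by
  have h1 := (indepFun_iff_map_prod_eq_prod_map_map hV.aemeasurable hU).1 h
  rw [← lintegral_map' (f := F) hF.aemeasurable (hV.aemeasurable.prodMk hU), h1,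
    lintegral_prod _ hF.aemeasurable, lintegral_map hF.lintegral_prod_right' hV]
  refine lintegral_congr fun ω => ?_
  rw [lintegral_map' (by fun_prop) hU]

/-- Conditioning on `V` a function of `V` and of a variable `U` independent of `V`. -/
lemma condLExp_comap_of_indepFun {V : Ω → 𝓥} {U : Ω → 𝓤} (hV : Measurable V)
    (hU : AEMeasurable U μ) (h : IndepFun V U μ) {F : 𝓥 × 𝓤 → ℝ≥0∞} (hF : Measurable F) :
    condLExp (MeasurableSpace.comap V inferInstance) μ (fun ω => F (V ω, U ω))
      =ᵐ[μ] fun ω => ∫⁻ ω', F (V ω, U ω') ∂μ := by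
  have hle : MeasurableSpace.comap V inferInstance ≤ ‹MeasurableSpace Ω› := hV.comap_le
  have hm : Measurable fun v => ∫⁻ ω', F (v, U ω') ∂μ := by
    have : ∀ v, ∫⁻ ω', F (v, U ω') ∂μ = ∫⁻ u, F (v, u) ∂(μ.map U) := fun v => by
      rw [lintegral_map' (by fun_prop) hU]
    simp_rw [this]
    exact hF.lintegral_prod_right'
  refine (ae_eq_condLExp hle μ _ (hm.comp (comap_measurable V)) ?_).symm
  rintro s ⟨B, hB, rfl⟩
  have h2 := lintegral_of_indepFun hV hU h
    -- The test event depends on `V` only, so its indicator can be absorbed into the integrand and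
    -- the plain Fubini identity suffices.
    (F := fun p => B.indicator (fun _ => 1) p.1 * F p)
    (((measurable_const.indicator hB).comp measurable_fst).mul hF)
  rw [← lintegral_indicator (hV hB), ← lintegral_indicator (hV hB)]
  refine Eq.trans ?_ (h2.symm.trans ?_)
  · refine lintegral_congr fun ω => ?_
    by_cases hω : V ω ∈ B <;> simp [Set.indicator, hω]
  · refine lintegral_congr fun ω => ?_
    by_cases hω : V ω ∈ B <;> simp [Set.indicator, hω]

/-- If `X` is independent of `(V, U)` and `V`, `U` are independent, then `V` is independent of
`(U, X)`. -/
lemma indepFun_prodMk_of_indepFun {V : Ω → 𝓥} {U : Ω → 𝓤} {X : Ω → 𝓦} (hV : AEMeasurable V μ)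
    (hU : AEMeasurable U μ) (hX : AEMeasurable X μ) (hVU : IndepFun V U μ)
    (h : IndepFun X (fun ω => (V ω, U ω)) μ) : IndepFun V (fun ω => (U ω, X ω)) μ := by
  have hUX : IndepFun U X μ := (h.comp measurable_id measurable_snd).symm
  rw [indepFun_iff_map_prod_eq_prod_map_map hV (hU.prodMk hX),
    hUX.map_prod_eq_prod_map_map hU hX]
  have h1 := h.symm.map_prod_eq_prod_map_map (hV.prodMk hU) hX
  rw [hVU.map_prod_eq_prod_map_map hV hU] at h1
  have := Measure.isProbabilityMeasure_map hV
  have := Measure.isProbabilityMeasure_map hU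
  have := Measure.isProbabilityMeasure_map hX
  rw [← Measure.prodAssoc_prod, ← h1,
    AEMeasurable.map_map_of_aemeasurable (by fun_prop) (by fun_prop)]
  rfl

end CondLExp

end MassiveMIMO

/-! ### Covariances of the model and the MMSE estimate -/

namespace MassiveMIMO

/-- The index set of all Gaussian variables of the model. -/
abbrev GaussIndex (L M K τ : ℕ) : Type :=
  ((Fin L × Fin M × Fin K) ⊕ (Fin M × Fin τ)) ⊕ Fin M

variable {L M K τ : ℕ}

namespace Params

variable (p : Params L M K τ)

/-- The denominator `τ P ∑ j, β j k + 1` of the estimator: the variance of an entry of the `k`-th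
column of the projected pilots. -/
def pilotVar (k : Fin K) : ℝ := τ * p.P * ∑ j, p.β j k + 1

lemma tauP_nonneg : 0 ≤ (τ : ℝ) * p.P := mul_nonneg (Nat.cast_nonneg _) p.P_pos.le

lemma pilotVar_pos (k : Fin K) : 0 < p.pilotVar k := by
  have h := mul_nonneg p.tauP_nonneg (Finset.sum_nonneg (s := Finset.univ) fun j _ => (p.β_pos j k).le)
  unfold pilotVar
  linarith

/-- The variance of an entry of the `k`-th column of the estimation error `ξ_i`. -/
def errVar (i : Fin L) (k : Fin K) : ℝ :=
  p.β i k * (τ * p.P * ∑ j ∈ Finset.univ.erase i, p.β j k + 1) / p.pilotVar k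

lemma α_eq_sum_errVar (i : Fin L) : p.α i = ∑ k, p.errVar i k := rfl

/-- The factor of the estimator. -/
def gain (i : Fin L) (k : Fin K) : ℝ := Real.sqrt (τ * p.P) * p.β i k / p.pilotVar k

/-- Prior variance minus gain times the covariance of channel and projected pilot: the form in which
the covariance computation delivers the error variance. -/
lemma errVar_eq (i : Fin L) (k : Fin K) :
    p.errVar i k = p.β i k - p.gain i k * (p.β i k * Real.sqrt (τ * p.P)) := by
  have hq := (p.pilotVar_pos k).ne'
  have hs := Real.mul_self_sqrt p.tauP_nonneg
  have h : ∑ j ∈ Finset.univ.erase i, p.β j k = ∑ j, p.β j k - p.β i k := by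
    rw [← Finset.add_sum_erase Finset.univ _ (Finset.mem_univ i)]
    ring
  unfold errVar gain
  rw [h]
  field_simp
  rw [Real.sq_sqrt p.tauP_nonneg]
  unfold pilotVar
  ring

/-- The coefficients of `G_i` with respect to the Gaussian variables of the model. -/
def coefG (i : Fin L) (m : Fin M) (k : Fin K) : GaussIndex L M K τ → ℂ :=
  (Real.sqrt (p.β i k) : ℂ) • Pi.single (.inl (.inl (i, m, k))) 1

/-- The coefficients of the received pilots. -/
def coefY (m : Fin M) (t : Fin τ) : GaussIndex L M K τ → ℂ :=
  (Real.sqrt (τ * p.P) : ℂ) • ∑ i, ∑ k, p.Ψ t k • p.coefG i m k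
    + Pi.single (.inl (.inr (m, t))) 1

/-- The coefficients of the projected pilots. -/
def coefW (m : Fin M) (k : Fin K) : GaussIndex L M K τ → ℂ :=
  ∑ t, star (p.Ψ t k) • p.coefY m t

/-- The coefficients of the estimation error. -/
def coefξ (i : Fin L) (m : Fin M) (k : Fin K) : GaussIndex L M K τ → ℂ :=
  p.coefG i m k - (p.gain i k : ℂ) • p.coefW m k

lemma single_dotProduct_star_single {J : Type*} [Fintype J] [DecidableEq J] (i j : J) :
    (Pi.single i 1 : J → ℂ) ⬝ᵥ star (Pi.single j 1) = if i = j then 1 else 0 := by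
  simp [Pi.single_apply, eq_comm]

lemma sum_pilot (k k' : Fin K) : ∑ t, star (p.Ψ t k) * p.Ψ t k' = if k = k' then 1 else 0 := by
  have h := congrFun (congrFun p.pilot_orthonormal k) k'
  simpa [Matrix.mul_apply, Matrix.one_apply] using h

lemma cov_G_G (i i' : Fin L) (m m' : Fin M) (k k' : Fin K) :
    p.coefG i m k ⬝ᵥ star (p.coefG i' m' k')
      = if i = i' ∧ m = m' ∧ k = k' then (p.β i k : ℂ) else 0 := by
  simp only [coefG, star_smul, smul_dotProduct, dotProduct_smul, single_dotProduct_star_single,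
    Sum.inl.injEq, Prod.mk.injEq]
  split_ifs with h
  · obtain ⟨rfl, rfl, rfl⟩ := h
    simp only [smul_eq_mul, mul_one, RCLike.star_def, Complex.conj_ofReal]
    rw [← Complex.ofReal_mul, Real.mul_self_sqrt (p.β_pos _ _).le]
  · simp

lemma cov_G_Y (i : Fin L) (m m' : Fin M) (k : Fin K) (t : Fin τ) :
    p.coefG i m k ⬝ᵥ star (p.coefY m' t)
      = if m = m' then (p.β i k * Real.sqrt (τ * p.P) : ℂ) * star (p.Ψ t k) else 0 := by
  have h0 : p.coefG i m k ⬝ᵥ star (Pi.single (.inl (.inr (m', t))) 1) = 0 := by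
    simp [coefG]
  simp only [coefY, star_add, star_smul, star_sum, dotProduct_add, dotProduct_smul,
    dotProduct_sum, h0, add_zero, cov_G_G, smul_eq_mul, RCLike.star_def, Complex.conj_ofReal]
  rw [Finset.sum_eq_single i, Finset.sum_eq_single k]
  · by_cases h : m = m'
    · simp [h]
      ring
    · simp [h]
  · intro b _ hb
    simp [hb.symm]
  · simp
  · intro b _ hb
    simp [hb.symm]
  · simp

lemma cov_single_Y (m m' : Fin M) (t t' : Fin τ) :
    (Pi.single (.inl (.inr (m, t))) 1 : GaussIndex L M K τ → ℂ) ⬝ᵥ star (p.coefY m' t')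
      = if m = m' ∧ t = t' then 1 else 0 := by
  have h0 : ∀ i k, (Pi.single (.inl (.inr (m, t))) 1 : GaussIndex L M K τ → ℂ)
      ⬝ᵥ star (p.coefG i m' k) = 0 := by
    intro i k
    simp [coefG]
  simp only [coefY, star_add, star_smul, star_sum, dotProduct_add, dotProduct_smul,
    dotProduct_sum, h0, smul_zero, Finset.sum_const_zero, zero_add,
    single_dotProduct_star_single, Sum.inl.injEq, Sum.inr.injEq, Prod.mk.injEq]

lemma cov_Y_Y (m m' : Fin M) (t t' : Fin τ) :
    p.coefY m t ⬝ᵥ star (p.coefY m' t')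
      = if m = m' then (τ * p.P : ℂ) * (∑ k, p.Ψ t k * star (p.Ψ t' k) * ∑ i, (p.β i k : ℂ))
          + (if t = t' then 1 else 0) else 0 := by
  conv_lhs => rw [coefY]
  simp only [add_dotProduct, smul_dotProduct, sum_dotProduct, cov_G_Y, cov_single_Y, smul_eq_mul]
  have hs : (Real.sqrt (τ * p.P) : ℂ) * Real.sqrt (τ * p.P) = τ * p.P := by
    rw [← Complex.ofReal_mul, Real.mul_self_sqrt p.tauP_nonneg]
    push_cast
    rfl
  by_cases h : m = m'
  · simp only [h, true_and, if_true, ← hs]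
    congr 1
    rw [Finset.sum_comm]
    simp only [Finset.mul_sum]
    refine Finset.sum_congr rfl fun k _ => Finset.sum_congr rfl fun i _ => ?_
    ring
  · simp [h]

/-- Each row of Y has covariance I plus τP times a combination of pilot projections. Orthonormality
makes every pilot an eigenvector of it, with eigenvalue `pilotVar`, so projecting on a pilot loses
nothing about the channel. -/
lemma cov_W_Y (m m' : Fin M) (k : Fin K) (t : Fin τ) :
    p.coefW m k ⬝ᵥ star (p.coefY m' t)
      = if m = m' then (p.pilotVar k : ℂ) * star (p.Ψ t k) else 0 := by
  simp only [coefW, sum_dotProduct, smul_dotProduct, cov_Y_Y]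
  by_cases h : m = m'
  · simp only [h, if_true, smul_eq_mul, mul_add, Finset.sum_add_distrib]
    have h1 : ∑ t', star (p.Ψ t' k) * ((τ * p.P : ℂ) *
        ∑ k', p.Ψ t' k' * star (p.Ψ t k') * ∑ i, (p.β i k' : ℂ))
        = (τ * p.P : ℂ) * ∑ k', (∑ t', star (p.Ψ t' k) * p.Ψ t' k') *
          (star (p.Ψ t k') * ∑ i, (p.β i k' : ℂ)) := by
      simp only [Finset.mul_sum (s := Finset.univ (α := Fin K)), Finset.sum_mul]
      rw [Finset.sum_comm]
      refine Finset.sum_congr rfl fun k' _ => ?_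
      rw [Finset.mul_sum]
      refine Finset.sum_congr rfl fun t' _ => ?_
      ring
    rw [h1]
    simp only [sum_pilot]
    simp [pilotVar]
    ring
  · simp [h]

/-- The normal equation of linear estimation: the gain is the quotient of the factors of `star (p.Ψ
t k)` in `cov_G_Y` and `cov_W_Y`. -/
lemma cov_ξ_Y (i : Fin L) (m m' : Fin M) (k : Fin K) (t : Fin τ) :
    p.coefξ i m k ⬝ᵥ star (p.coefY m' t) = 0 := by
  simp only [coefξ, sub_dotProduct, smul_dotProduct, cov_G_Y, cov_W_Y]
  split_ifs with h
  · have hq : (p.pilotVar k : ℂ) ≠ 0 := by exact_mod_cast (p.pilotVar_pos k).ne'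
    simp only [gain, smul_eq_mul]
    push_cast
    field_simp
    ring
  · simp

lemma cov_ξ_W (i : Fin L) (m m' : Fin M) (k k' : Fin K) :
    p.coefξ i m k ⬝ᵥ star (p.coefW m' k') = 0 := by
  simp [coefW, star_sum, dotProduct_sum, cov_ξ_Y]

lemma cov_G_W (i : Fin L) (m m' : Fin M) (k k' : Fin K) :
    p.coefG i m k ⬝ᵥ star (p.coefW m' k')
      = if m = m' ∧ k = k' then (p.β i k * Real.sqrt (τ * p.P) : ℂ) else 0 := by
  simp only [coefW, star_sum, star_smul, dotProduct_sum, dotProduct_smul, cov_G_Y, star_star]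
  by_cases h : m = m'
  · have := p.sum_pilot k k'
    simp only [h, if_true, true_and, smul_eq_mul]
    have h1 : ∀ t, p.Ψ t k' * ((p.β i k * Real.sqrt (τ * p.P) : ℂ) * star (p.Ψ t k))
        = (p.β i k * Real.sqrt (τ * p.P) : ℂ) * (star (p.Ψ t k) * p.Ψ t k') := fun t => by ring
    simp only [h1, ← Finset.mul_sum, this]
    simp
  · simp [h]

lemma cov_W_W (m m' : Fin M) (k k' : Fin K) :
    p.coefW m k ⬝ᵥ star (p.coefW m' k')
      = if m = m' ∧ k = k' then (p.pilotVar k : ℂ) else 0 := by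
  conv_lhs => rw [coefW.eq_1 p m' k']
  simp only [star_sum, star_smul, dotProduct_sum, dotProduct_smul, cov_W_Y, star_star]
  by_cases h : m = m'
  · have := p.sum_pilot k k'
    simp only [h, if_true, true_and, smul_eq_mul]
    have h1 : ∀ t, p.Ψ t k' * ((p.pilotVar k : ℂ) * star (p.Ψ t k))
        = (p.pilotVar k : ℂ) * (star (p.Ψ t k) * p.Ψ t k') := fun t => by ring
    simp only [h1, ← Finset.mul_sum, this]
    simp
  · simp [h]

lemma cov_ξ_ξ (i : Fin L) (m m' : Fin M) (k k' : Fin K) :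
    p.coefξ i m k ⬝ᵥ star (p.coefξ i m' k')
      = if m = m' ∧ k = k' then (p.errVar i k : ℂ) else 0 := by
  -- Only the second factor is expanded: the error is orthogonal to the projected pilots, so its
  -- covariance with itself is that with G.
  conv_lhs => rw [coefξ.eq_1 p i m' k']
  rw [star_sub, star_smul, dotProduct_sub, dotProduct_smul, cov_ξ_W, smul_zero, sub_zero, coefξ,
    sub_dotProduct, smul_dotProduct, Matrix.dotProduct_star (p.coefW m k), cov_G_W, cov_G_G]
  by_cases h : m = m' ∧ k = k'
  · obtain ⟨rfl, rfl⟩ := h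
    simp [errVar_eq]
  · have h2 : ¬ (m' = m ∧ k' = k) := fun h' => h ⟨h'.1.symm, h'.2.symm⟩
    simp [h, h2]

lemma cov_noise_W (m m' : Fin M) (k : Fin K) :
    (Pi.single (.inr m) 1 : GaussIndex L M K τ → ℂ) ⬝ᵥ star (p.coefW m' k) = 0 := by
  simp [coefW, coefY, coefG, star_sum]

end Params

namespace Signals

variable {Ω : Type*} [MeasurableSpace Ω] {μ : Measure Ω}
variable (S : Signals L M K τ μ) (p : Params L M K τ)

/-- All Gaussian variables of the model in one vector. -/
def gauss (ω : Ω) : GaussIndex L M K τ → ℂ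
  | .inl (.inl (i, m, k)) => S.H i ω m k
  | .inl (.inr (m, t)) => S.N ω m t
  | .inr m => S.n ω m

lemma measurable_gauss : Measurable S.gauss := by
  refine measurable_pi_iff.2 ?_
  rintro ((⟨i, m, k⟩ | ⟨m, t⟩) | m)
  · exact S.measurable_H i m k
  · exact S.measurable_N m t
  · exact S.measurable_n m

lemma hasLaw_gauss [IsProbabilityMeasure μ] : HasLaw S.gauss (gaussVec _) μ := by
  have hm := measurable_pi_iff.1 S.measurable_gauss
  refine (iIndepFun_iff_hasLaw_pi_pi (X := fun j ω => S.gauss ω j) ?_).1 ?_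
  · rintro ((⟨i, m, k⟩ | ⟨m, t⟩) | m)
    · exact ⟨(hm _).aemeasurable, S.law_H i m k⟩
    · exact ⟨(hm _).aemeasurable, S.law_N m t⟩
    · exact ⟨(hm _).aemeasurable, S.law_n m⟩
  · convert S.indep_gaussian using 2 with j
    ext ω
    rcases j with ((⟨i, m, k⟩ | ⟨m, t⟩) | m) <;> rfl

lemma G_eq (i : Fin L) (ω : Ω) (m : Fin M) (k : Fin K) :
    S.G p i ω m k = p.coefG i m k ⬝ᵥ S.gauss ω := by
  simp [G, Params.coefG, Matrix.mul_diagonal, gauss, mul_comm]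

lemma pilotY_eq (ω : Ω) (m : Fin M) (t : Fin τ) :
    S.pilotY p ω m t = p.coefY m t ⬝ᵥ S.gauss ω := by
  simp only [pilotY, Params.coefY, Matrix.add_apply, Matrix.smul_apply, Matrix.sum_apply,
    Matrix.mul_apply, Matrix.transpose_apply, add_dotProduct, smul_dotProduct, sum_dotProduct,
    ← G_eq, single_one_dotProduct, smul_eq_mul]
  simp [gauss, mul_comm]

lemma pilotProj_eq (ω : Ω) (m : Fin M) (k : Fin K) :
    S.pilotProj p ω m k = p.coefW m k ⬝ᵥ S.gauss ω := by
  simp only [pilotProj, Params.coefW, Matrix.mul_apply, pilotY_eq, sum_dotProduct,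
    smul_dotProduct, Matrix.map_apply, smul_eq_mul]
  exact Finset.sum_congr rfl fun t _ => mul_comm _ _

lemma Ghat_eq (i : Fin L) (ω : Ω) (m : Fin M) (k : Fin K) :
    S.Ghat p i ω m k = p.gain i k * S.pilotProj p ω m k := by
  rw [Ghat, Matrix.mul_diagonal, mul_comm]
  rfl

lemma ξ_eq (i : Fin L) (ω : Ω) (m : Fin M) (k : Fin K) :
    S.ξ p i ω m k = p.coefξ i m k ⬝ᵥ S.gauss ω := by
  rw [ξ, Matrix.sub_apply, Ghat_eq, pilotProj_eq, G_eq, Params.coefξ, sub_dotProduct,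
    smul_dotProduct, smul_eq_mul]

lemma measurable_dotProduct_gauss (a : GaussIndex L M K τ → ℂ) :
    Measurable fun ω => a ⬝ᵥ S.gauss ω := by
  have := S.measurable_gauss
  unfold dotProduct
  fun_prop

lemma measurable_pilotY : Measurable fun ω m t => S.pilotY p ω m t := by
  simp only [pilotY_eq]
  have := S.measurable_dotProduct_gauss
  fun_prop

lemma measurable_ξ (i : Fin L) : Measurable fun ω m k => S.ξ p i ω m k := by
  simp only [ξ_eq]
  have := S.measurable_dotProduct_gauss
  fun_prop

lemma measurable_Ghat (i : Fin L) : Measurable fun ω m k => S.Ghat p i ω m k := by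
  simp only [Ghat_eq, pilotProj_eq]
  have := S.measurable_dotProduct_gauss
  fun_prop

variable [IsProbabilityMeasure μ]

lemma memLp_dotProduct_gauss (a : GaussIndex L M K τ → ℂ) :
    MemLp (fun ω => a ⬝ᵥ S.gauss ω) 2 μ :=
  memLp_dotProduct (memLp_of_hasLaw_gaussVec S.hasLaw_gauss) a

/-- The estimation error is independent of the received pilots. -/
lemma indepFun_ξ_pilotY (i : Fin L) :
    IndepFun (fun ω m k => S.ξ p i ω m k) (fun ω m t => S.pilotY p ω m t) μ := by
  have h := indepFun_dotProduct S.hasLaw_gauss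
    (fun x : Fin M × Fin K => p.coefξ i x.1 x.2) (fun x : Fin M × Fin τ => p.coefY x.1 x.2)
    fun x y => p.cov_ξ_Y i x.1 y.1 x.2 y.2
  have h1 : Measurable fun (f : Fin M × Fin K → ℂ) (m : Fin M) (k : Fin K) => f (m, k) := by
    fun_prop
  have h2 : Measurable fun (f : Fin M × Fin τ → ℂ) (m : Fin M) (t : Fin τ) => f (m, t) := by
    fun_prop
  simp only [ξ_eq, pilotY_eq]
  exact h.comp h1 h2

/-- `Ĝ_i` is the conditional expectation of `G_i` given the received pilots. -/
lemma condExp_G (i : Fin L) (m : Fin M) (k : Fin K) :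
    μ[fun ω => S.G p i ω m k | S.pilotSigma p] =ᵐ[μ] fun ω => S.Ghat p i ω m k := by
  have hle : S.pilotSigma p ≤ ‹MeasurableSpace Ω› := (S.measurable_pilotY p).comap_le
  have hG : (fun ω => S.G p i ω m k)
      = (fun ω => S.ξ p i ω m k) + fun ω => S.Ghat p i ω m k := by
    ext ω
    simp [ξ]
  have hiξ : Integrable (fun ω => S.ξ p i ω m k) μ := by
    simp only [ξ_eq]
    exact (S.memLp_dotProduct_gauss _).integrable (by norm_num)
  have hiG : Integrable (fun ω => S.Ghat p i ω m k) μ := by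
    simp only [Ghat_eq, pilotProj_eq]
    exact ((S.memLp_dotProduct_gauss _).integrable (by norm_num)).const_mul _
  -- The estimate is a linear function of Y, hence unchanged by conditioning; only the error has to
  -- be shown to average to zero.
  have hmG : StronglyMeasurable[S.pilotSigma p] fun ω => S.Ghat p i ω m k := by
    have h1 : Measurable fun (y : Fin M → Fin τ → ℂ) =>
        (p.gain i k : ℂ) * ∑ t, y m t * star (p.Ψ t k) := by fun_prop
    have h2 := (h1.comp (comap_measurable fun ω m t => S.pilotY p ω m t)).stronglyMeasurable
    convert h2 using 2 with ω
    simp [Ghat_eq, pilotProj, Matrix.mul_apply]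
  have hξ : μ[fun ω => S.ξ p i ω m k | S.pilotSigma p] =ᵐ[μ] fun _ => 0 := by
    have h1 : ∫ ω, S.ξ p i ω m k ∂μ = 0 := by
      simp only [ξ_eq]
      exact integral_dotProduct_of_hasLaw S.hasLaw_gauss _
    have h2 : StronglyMeasurable[MeasurableSpace.comap (fun ω m k => S.ξ p i ω m k) inferInstance]
        fun ω => S.ξ p i ω m k := by
      have h3 : Measurable fun (y : Fin M → Fin K → ℂ) => y m k := by fun_prop
      exact (h3.comp (comap_measurable fun ω m k => S.ξ p i ω m k)).stronglyMeasurable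
    have h3 := condExp_indep_eq (S.measurable_ξ p i).comap_le hle h2 (S.indepFun_ξ_pilotY p i)
    simpa only [h1] using h3
  rw [hG]
  refine (condExp_add hiξ hiG _).trans ?_
  filter_upwards [hξ] with ω hω
  rw [Pi.add_apply, hω, zero_add, condExp_of_stronglyMeasurable hle hmG hiG]

/-- The error covariance matrix. -/
lemma integral_ξ_mul_conjTranspose (i : Fin L) (m m' : Fin M) :
    ∫ ω, (S.ξ p i ω * (S.ξ p i ω)ᴴ) m m' ∂μ = if m = m' then (p.α i : ℂ) else 0 := by
  simp only [Matrix.mul_apply, Matrix.conjTranspose_apply, ξ_eq]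
  have h (k : Fin K) := integral_dotProduct_mul_star (memLp_of_hasLaw_gaussVec S.hasLaw_gauss)
    (integral_mul_star_of_hasLaw_gaussVec S.hasLaw_gauss) (p.coefξ i m k) (p.coefξ i m' k)
  have hi (k : Fin K) : Integrable (fun ω => (p.coefξ i m k ⬝ᵥ S.gauss ω)
      * star (p.coefξ i m' k ⬝ᵥ S.gauss ω)) μ :=
    (S.memLp_dotProduct_gauss _).integrable_mul (S.memLp_dotProduct_gauss _).star
  rw [integral_finsetSum _ fun k _ => hi k]
  simp only [h, Params.cov_ξ_ξ, Params.α_eq_sum_errVar]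
  by_cases hm : m = m' <;> simp [hm]

end Signals

end MassiveMIMO

/-! ### The Erlang law and its image under the SINR map -/

namespace MassiveMIMO

/-- With variance 1/2 the density is exp(-x²) / √π, and the integral is a complex square root.
Squaring removes the root, and the square is what the two coordinates of CN(0, 1) need. -/
lemma integral_exp_sq_gaussianReal_half (t : ℝ) :
    (∫ x, Complex.exp (t * x ^ 2 * Complex.I) ∂(gaussianReal 0 (1 / 2))) ^ 2
      = (1 - t * Complex.I)⁻¹ := by
  rw [integral_gaussianReal_eq_integral_smul (by norm_num)]
  have h1 : ∀ x : ℝ, gaussianPDFReal 0 (1 / 2) x • Complex.exp (t * x ^ 2 * Complex.I)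
      = ((Real.sqrt Real.pi)⁻¹ : ℂ) * Complex.exp (-(1 - t * Complex.I) * x ^ 2) := by
    intro x
    rw [gaussianPDFReal, Complex.real_smul]
    push_cast
    rw [mul_assoc, ← Complex.exp_add]
    congr 2
    · have h2 : ((Real.sqrt 2 : ℝ) : ℂ) ≠ 0 := by
        exact_mod_cast (Real.sqrt_pos.2 two_pos).ne'
      norm_num
      field_simp
    · norm_num
      ring
  simp_rw [h1]
  have hre : 0 < (1 - t * Complex.I).re := by simp
  have hne : (1 - t * Complex.I) ≠ 0 := fun h => by simp [h] at hre
  rw [integral_const_mul, integral_gaussian_complex hre, mul_pow, ← Complex.cpow_nat_mul]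
  have hpi : (Real.pi : ℂ) ≠ 0 := by exact_mod_cast Real.pi_ne_zero
  have hsq : ((Real.sqrt Real.pi : ℝ) : ℂ) ^ 2 = Real.pi := by
    rw [← Complex.ofReal_pow, Real.sq_sqrt Real.pi_pos.le]
  rw [inv_pow, hsq]
  norm_num
  field_simp

lemma charFun_map_norm_sq (t : ℝ) :
    charFun (stdComplexGaussian.map fun z => ‖z‖ ^ 2) t = (1 - t * Complex.I)⁻¹ := by
  rw [charFun_apply_real, integral_map (by fun_prop) (by fun_prop), stdComplexGaussian,
    integral_map measurable_complexMk.aemeasurable (by fun_prop)]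
  have h1 : ∀ q : ℝ × ℝ, Complex.exp (t * ((‖(⟨q.1, q.2⟩ : ℂ)‖ ^ 2 : ℝ) : ℂ) * Complex.I)
      = Complex.exp (t * q.1 ^ 2 * Complex.I) * Complex.exp (t * q.2 ^ 2 * Complex.I) := by
    intro q
    rw [← Complex.exp_add, ← Complex.normSq_eq_norm_sq, Complex.normSq_apply]
    push_cast
    congr 1
    ring
  simp_rw [h1]
  rw [integral_prod_mul (f := fun x : ℝ => Complex.exp (t * x ^ 2 * Complex.I))
    (g := fun x : ℝ => Complex.exp (t * x ^ 2 * Complex.I)), ← sq,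
    integral_exp_sq_gaussianReal_half]

/-- The law of the sum of `n + 1` independent exponential variables of rate `1`. -/
def erlangMeasure (n : ℕ) : Measure ℝ :=
  (volume.restrict (Set.Ioi 0)).withDensity fun x => ENNReal.ofReal (x ^ n / n ! * Real.exp (-x))

lemma integrableOn_pow_mul_exp_neg (n : ℕ) :
    IntegrableOn (fun x : ℝ => x ^ n / n ! * Real.exp (-x)) (Set.Ioi 0) := by
  have h := (Real.GammaIntegral_convergent (s := n + 1) (by positivity)).mul_const ((n ! : ℝ)⁻¹)
  refine IntegrableOn.congr_fun h (fun x _ => ?_) measurableSet_Ioi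
  simp
  ring

instance (n : ℕ) : IsFiniteMeasure (erlangMeasure n) :=
  isFiniteMeasure_withDensity_ofReal (integrableOn_pow_mul_exp_neg n).2

lemma norm_pow_mul_exp_neg (n : ℕ) (t : ℝ) {x : ℝ} (hx : 0 ≤ x) :
    ‖(x : ℂ) ^ n * Complex.exp (-((1 - t * Complex.I) * x))‖ = x ^ n * Real.exp (-x) := by
  rw [norm_mul, norm_pow, Complex.norm_real, Complex.norm_exp, Real.norm_of_nonneg hx]
  simp

lemma integrableOn_pow_mul_cexp_neg (n : ℕ) (t : ℝ) :
    IntegrableOn (fun x : ℝ => (x : ℂ) ^ n * Complex.exp (-((1 - t * Complex.I) * x)))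
      (Set.Ioi 0) := by
  have h := (integrableOn_pow_mul_exp_neg n).mul_const (n ! : ℝ)
  refine Integrable.mono' h (by fun_prop) ?_
  refine (ae_restrict_iff' measurableSet_Ioi).2 (Filter.Eventually.of_forall fun x hx => ?_)
  rw [norm_pow_mul_exp_neg n t (le_of_lt hx)]
  have : (n ! : ℝ) ≠ 0 := by exact_mod_cast n.factorial_ne_zero
  apply le_of_eq
  field_simp

lemma tendsto_pow_mul_cexp_neg (n : ℕ) (t : ℝ) :
    Filter.Tendsto (fun x : ℝ => (x : ℂ) ^ n * Complex.exp (-((1 - t * Complex.I) * x)))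
      Filter.atTop (nhds 0) := by
  rw [tendsto_zero_iff_norm_tendsto_zero]
  refine (Real.tendsto_pow_mul_exp_neg_atTop_nhds_zero n).congr' ?_
  filter_upwards [Filter.eventually_ge_atTop 0] with x hx
  exact (norm_pow_mul_exp_neg n t hx).symm

/-- Integration by parts in the form of an induction: x^(n+1) exp(-bx) vanishes at 0 and at
infinity, so its derivative integrates to zero and links consecutive powers. The complex b has real
part 1, which gives the decay. -/
lemma integral_pow_mul_cexp_neg (n : ℕ) (t : ℝ) :
    ∫ x in Set.Ioi (0 : ℝ), (x : ℂ) ^ n * Complex.exp (-((1 - t * Complex.I) * x))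
      = n ! * ((1 - t * Complex.I)⁻¹) ^ (n + 1) := by
  set b : ℂ := 1 - t * Complex.I with hb
  have hre : b.re = 1 := by simp [hb]
  have hne : b ≠ 0 := fun h => by simp [h] at hre
  have hexp : ∀ x : ℝ, HasDerivAt (fun x : ℝ => Complex.exp (-(b * x)))
      (-b * Complex.exp (-(b * x))) x := by
    intro x
    have h1 : HasDerivAt (fun x : ℝ => (x : ℂ)) 1 x := Complex.ofRealCLM.hasDerivAt
    convert! ((h1.const_mul b).neg).cexp using 1
    simp [mul_comm]
  have hpow : ∀ (n : ℕ) (x : ℝ), HasDerivAt (fun x : ℝ => (x : ℂ) ^ n)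
      (n * (x : ℂ) ^ (n - 1)) x := by
    intro n x
    have h1 : HasDerivAt (fun x : ℝ => (x : ℂ)) 1 x := Complex.ofRealCLM.hasDerivAt
    convert! h1.pow n using 1
    simp
  induction n with
  | zero =>
    have h := integral_Ioi_of_hasDerivAt_of_tendsto' (a := 0) (fun x _ => hexp x)
      (IntegrableOn.congr_fun ((integrableOn_pow_mul_cexp_neg 0 t).const_mul (-b))
        (by intro x _; simp [hb]) measurableSet_Ioi)
      (by simpa [hb] using tendsto_pow_mul_cexp_neg 0 t)
    rw [integral_const_mul] at h
    simp only [Complex.ofReal_zero, mul_zero, neg_zero, Complex.exp_zero] at h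
    simp only [pow_zero, one_mul]
    rw [Nat.factorial_zero, Nat.cast_one, one_mul, zero_add, pow_one]
    refine eq_inv_of_mul_eq_one_right ?_
    linear_combination -h
  | succ n ih =>
    have h := integral_Ioi_of_hasDerivAt_of_tendsto' (a := 0)
      (fun x _ => (hpow (n + 1) x).mul (hexp x)) (m := 0)
      (IntegrableOn.congr_fun
        (((integrableOn_pow_mul_cexp_neg n t).const_mul ((n + 1 : ℕ) : ℂ)).add
          ((integrableOn_pow_mul_cexp_neg (n + 1) t).const_mul (-b)))
        (by intro x _; simp [hb]; ring) measurableSet_Ioi)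
      (tendsto_pow_mul_cexp_neg (n + 1) t)
    have h2 : ∀ x : ℝ, ((n + 1 : ℕ) : ℂ) * (x : ℂ) ^ (n + 1 - 1) * Complex.exp (-(b * x))
        + (x : ℂ) ^ (n + 1) * (-b * Complex.exp (-(b * x)))
        = ((n + 1 : ℕ) : ℂ) * ((x : ℂ) ^ n * Complex.exp (-(b * x)))
          + (-b) * ((x : ℂ) ^ (n + 1) * Complex.exp (-(b * x))) := by
      intro x
      simp
      ring
    simp_rw [h2] at h
    rw [integral_add ((integrableOn_pow_mul_cexp_neg n t).const_mul _)
      ((integrableOn_pow_mul_cexp_neg (n + 1) t).const_mul _), integral_const_mul,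
      integral_const_mul, ih] at h
    simp only [Pi.mul_apply, Complex.ofReal_zero, ne_eq, Nat.add_eq_zero_iff, one_ne_zero,
      and_false, not_false_eq_true, zero_pow, zero_mul, sub_zero] at h
    have h3 : ∫ x in Set.Ioi (0 : ℝ), (x : ℂ) ^ (n + 1) * Complex.exp (-(b * x))
        = b⁻¹ * (((n + 1 : ℕ) : ℂ) * (n ! * (b⁻¹) ^ (n + 1))) := by
      rw [eq_inv_mul_iff_mul_eq₀ hne]
      linear_combination -h
    rw [h3, Nat.factorial_succ]
    push_cast
    ring

lemma charFun_erlangMeasure (n : ℕ) (t : ℝ) :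
    charFun (erlangMeasure n) t = ((1 - t * Complex.I)⁻¹) ^ (n + 1) := by
  rw [charFun_apply_real, erlangMeasure, integral_withDensity_eq_integral_toReal_smul
    (by fun_prop) (by simp)]
  have h1 : ∀ x ∈ Set.Ioi (0 : ℝ), (ENNReal.ofReal (x ^ n / n ! * Real.exp (-x))).toReal
        • Complex.exp (t * x * Complex.I)
      = ((n ! : ℂ)⁻¹) * ((x : ℂ) ^ n * Complex.exp (-((1 - t * Complex.I) * x))) := by
    intro x hx
    have hx0 : (0 : ℝ) < x := hx
    rw [ENNReal.toReal_ofReal (by positivity), Complex.real_smul]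
    push_cast
    rw [mul_assoc, ← Complex.exp_add]
    have h3 : -(x : ℂ) + t * x * Complex.I = -((1 - t * Complex.I) * x) := by ring
    rw [h3]
    ring
  rw [setIntegral_congr_fun measurableSet_Ioi h1, integral_const_mul, integral_pow_mul_cexp_neg]
  have : (n ! : ℂ) ≠ 0 := by exact_mod_cast n.factorial_ne_zero
  rw [inv_mul_cancel_left₀ this]

/-- The squared length of `n + 1` independent `CN(0, 1)` variables has an Erlang law. -/
theorem hasLaw_sum_norm_sq {ι Ω : Type*} [Fintype ι] [MeasurableSpace Ω] {μ : Measure Ω}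
    [IsProbabilityMeasure μ] {Z : Ω → ι → ℂ} (hZ : HasLaw Z (gaussVec ι) μ) {n : ℕ}
    (hn : Fintype.card ι = n + 1) :
    HasLaw (fun ω => ∑ i, ‖Z ω i‖ ^ 2) (erlangMeasure n) μ := by
  classical
  have hm : ∀ i, AEMeasurable (fun ω => Z ω i) μ := fun i => (hasLaw_eval_gaussVec hZ i).aemeasurable
  have hsm : AEMeasurable (fun ω => ∑ i, ‖Z ω i‖ ^ 2) μ :=
    Finset.aemeasurable_fun_sum _ fun i _ => (hm i).norm.pow_const 2
  refine ⟨hsm, Measure.ext_of_charFun (funext fun t => ?_)⟩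
  have hi := (iIndepFun_of_hasLaw_gaussVec hZ).comp (fun _ z => ‖z‖ ^ 2) (fun _ => by fun_prop)
  -- Independence makes the characteristic function a product of factors 1 / (1 - it), one for each
  -- coordinate.
  have h2 := hi.charFun_map_fun_sum_eq_prod (fun i => (hm i).norm.pow_const 2)
  rw [h2, charFun_erlangMeasure, Finset.prod_apply]
  have h3 : ∀ i, charFun (μ.map fun ω => ‖Z ω i‖ ^ 2) t = (1 - t * Complex.I)⁻¹ := by
    intro i
    rw [← charFun_map_norm_sq, ← (hasLaw_eval_gaussVec hZ i).map_eq,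
      AEMeasurable.map_map_of_aemeasurable (by fun_prop) (hm i)]
    rfl
  simp [h3, hn]

/-- Differentiating the truncated exponential series drops its top term; against the derivative of
exp(-x) everything else cancels. -/
lemma hasDerivAt_erlang (n : ℕ) (x : ℝ) :
    HasDerivAt (fun x => -(Real.exp (-x) * ∑ i ∈ Finset.range (n + 1), x ^ i / (i ! : ℝ)))
      (x ^ n / n ! * Real.exp (-x)) x := by
  have he : HasDerivAt (fun x : ℝ => Real.exp (-x)) (-Real.exp (-x)) x := by
    simpa using (hasDerivAt_neg x).exp
  have hs : ∀ n : ℕ, HasDerivAt (fun x : ℝ => ∑ i ∈ Finset.range (n + 1), x ^ i / (i ! : ℝ))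
      (∑ i ∈ Finset.range n, x ^ i / (i ! : ℝ)) x := by
    intro n
    induction n with
    | zero => simpa using hasDerivAt_const x (1 : ℝ)
    | succ n ih =>
      simp_rw [Finset.sum_range_succ _ (n + 1)]
      rw [Finset.sum_range_succ _ n]
      refine ih.add ?_
      convert! (hasDerivAt_pow (n + 1) x).div_const ((n + 1)! : ℝ) using 1
      rw [Nat.factorial_succ]
      push_cast
      have : (n ! : ℝ) ≠ 0 := by exact_mod_cast n.factorial_ne_zero
      have : (n + 1 : ℝ) ≠ 0 := by positivity
      field_simp
  convert! (he.mul (hs n)).neg using 1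
  rw [Finset.sum_range_succ]
  ring

lemma erlangMeasure_Iic (n : ℕ) {x : ℝ} (hx : 0 ≤ x) :
    (erlangMeasure n).real (Set.Iic x)
      = 1 - Real.exp (-x) * ∑ i ∈ Finset.range (n + 1), x ^ i / (i ! : ℝ) := by
  have hi := integrableOn_pow_mul_exp_neg n
  have hset : Set.Iic x ∩ Set.Ioi 0 = Set.Ioc 0 x := by
    ext y
    simp [and_comm]
  rw [measureReal_def, erlangMeasure, withDensity_apply _ measurableSet_Iic,
    Measure.restrict_restrict measurableSet_Iic, hset,
    ← ofReal_integral_eq_lintegral_ofReal (hi.mono_set Set.Ioc_subset_Ioi_self),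
    ← intervalIntegral.integral_of_le hx,
    intervalIntegral.integral_eq_sub_of_hasDerivAt (fun y _ => hasDerivAt_erlang n y)
      (Continuous.intervalIntegrable (by fun_prop) _ _), ENNReal.toReal_ofReal]
  -- At the lower limit 0 only the term of index 0 survives; it supplies the 1 of the formula.
  · rw [Finset.sum_range_succ' (fun i => (0 : ℝ) ^ i / (i ! : ℝ))]
    simp
    ring
  · have h1 := intervalIntegral.integral_eq_sub_of_hasDerivAt
      (a := 0) (b := x) (fun y _ => hasDerivAt_erlang n y)
      (Continuous.intervalIntegrable (by fun_prop) _ _)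
    rw [← h1]
    refine intervalIntegral.integral_nonneg hx fun u hu => ?_
    have := hu.1
    positivity
  · refine (ae_restrict_iff' measurableSet_Ioc).2 (Filter.Eventually.of_forall fun y hy => ?_)
    have := hy.1
    simp only [Pi.zero_apply]
    positivity

section SINR

variable {θ η : ℝ}

lemma hasDerivAt_sinrInv {s : ℝ} (hs : 1 - η * s ≠ 0) :
    HasDerivAt (fun s => θ * s / (1 - η * s)) (θ / (1 - η * s) ^ 2) s := by
  have h1 : HasDerivAt (fun s => θ * s) θ s := by
    simpa using (hasDerivAt_id s).const_mul θ
  have h2 : HasDerivAt (fun s => 1 - η * s) (-η) s := by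
    simpa using ((hasDerivAt_id s).const_mul η).const_sub 1
  convert! h1.div h2 hs using 1
  field_simp
  ring

lemma one_sub_mul_pos (hη : 0 < η) {s : ℝ} (hs : s < 1 / η) : 0 < 1 - η * s := by
  rw [lt_div_iff₀ hη] at hs
  linarith

/-- Together with `sinr_sinrInv` this shows that the SINR map and s ↦ θs / (1 - ηs) are inverse
bijections between (0, ∞) and (0, 1/η). -/
lemma sinrInv_sinr (hθ : 0 < θ) (hη : 0 < η) {x : ℝ} (hx : 0 < x) :
    x / (θ + η * x) < 1 / η ∧ 0 < x / (θ + η * x) ∧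
      θ * (x / (θ + η * x)) / (1 - η * (x / (θ + η * x))) = x := by
  have h : 0 < θ + η * x := by positivity
  refine ⟨?_, by positivity, ?_⟩
  · rw [div_lt_div_iff₀ h hη]
    nlinarith
  · have h1 : 1 - η * (x / (θ + η * x)) = θ / (θ + η * x) := by
      field_simp
      ring
    rw [h1]
    field_simp

lemma sinr_sinrInv (hθ : 0 < θ) (hη : 0 < η) {s : ℝ} (hs : s < 1 / η) :
    (θ * s / (1 - η * s)) / (θ + η * (θ * s / (1 - η * s))) = s := by
  have h := one_sub_mul_pos hη hs
  have h1 : θ + η * (θ * s / (1 - η * s)) = θ / (1 - η * s) := by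
    field_simp
    ring
  rw [h1, div_div_div_cancel_right₀ h.ne', mul_div_cancel_left₀ _ hθ.ne']

lemma sinr_le_iff (hθ : 0 < θ) (hη : 0 < η) {x s : ℝ} (hx : 0 < x) (hs : s < 1 / η) :
    x / (θ + η * x) ≤ s ↔ x ≤ θ * s / (1 - η * s) := by
  have h := one_sub_mul_pos hη hs
  rw [div_le_iff₀ (by positivity), le_div_iff₀ h]
  constructor <;> intro h <;> nlinarith

/-- The law of `T / (θ + η T)` for an Erlang variable `T`. -/
theorem map_erlangMeasure_sinr (hθ : 0 < θ) (hη : 0 < η) (n : ℕ) :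
    (erlangMeasure n).map (fun x => x / (θ + η * x))
      = volume.withDensity fun s => ENNReal.ofReal
        (if 0 < s ∧ s < 1 / η then
          θ ^ (n + 1) / (n ! : ℝ) * (s ^ n / (1 - η * s) ^ (n + 2)) *
            Real.exp (-(θ * s / (1 - η * s)))
        else 0) := by
  ext B hB
  have hφ : Measurable fun x : ℝ => x / (θ + η * x) := by fun_prop
  set u : ℝ → ℝ := fun s => θ * s / (1 - η * s) with hu
  have himg : u '' (Set.Ioo 0 (1 / η) ∩ B)
      = (fun x : ℝ => x / (θ + η * x)) ⁻¹' B ∩ Set.Ioi 0 := by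
    ext x
    constructor
    · rintro ⟨s, ⟨⟨hs0, hs1⟩, hsB⟩, rfl⟩
      have h := one_sub_mul_pos hη hs1
      refine ⟨?_, ?_⟩
      · simpa only [Set.mem_preimage, hu, sinr_sinrInv hθ hη hs1] using hsB
      · simp only [Set.mem_Ioi, hu]
        positivity
    · rintro ⟨hxB, hx⟩
      obtain ⟨h1, h2, h3⟩ := sinrInv_sinr hθ hη hx
      exact ⟨x / (θ + η * x), ⟨⟨h2, h1⟩, hxB⟩, h3⟩
  have hms : MeasurableSet (Set.Ioo 0 (1 / η) ∩ B) := measurableSet_Ioo.inter hB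
  -- Change of variables along the inverse map `u`; injectivity comes from its left inverse
  -- `sinr_sinrInv`.
  have hcv := lintegral_image_eq_lintegral_abs_deriv_mul hms (f := u)
    (f' := fun s => θ / (1 - η * s) ^ 2)
    (fun s hs => (hasDerivAt_sinrInv (one_sub_mul_pos hη hs.1.2).ne').hasDerivWithinAt)
    (fun s hs s' hs' h => by
      rw [← sinr_sinrInv hθ hη hs.1.2, ← sinr_sinrInv hθ hη hs'.1.2]
      simp only [hu] at h
      rw [h])
    (fun x => ENNReal.ofReal (x ^ n / n ! * Real.exp (-x)))
  rw [Measure.map_apply hφ hB, erlangMeasure, withDensity_apply _ (hφ hB),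
    Measure.restrict_restrict (hφ hB), ← himg, hcv, withDensity_apply _ hB]
  have hrhs : ∀ s : ℝ, ENNReal.ofReal (if 0 < s ∧ s < 1 / η then
          θ ^ (n + 1) / (n ! : ℝ) * (s ^ n / (1 - η * s) ^ (n + 2)) *
            Real.exp (-(θ * s / (1 - η * s)))
        else 0) = (Set.Ioo 0 (1 / η)).indicator (fun s => ENNReal.ofReal
          (θ ^ (n + 1) / (n ! : ℝ) * (s ^ n / (1 - η * s) ^ (n + 2)) *
            Real.exp (-(θ * s / (1 - η * s))))) s := by
    intro s
    by_cases h : 0 < s ∧ s < 1 / η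
    · rw [if_pos h, Set.indicator_of_mem (show s ∈ Set.Ioo 0 (1 / η) from h)]
    · rw [if_neg h, Set.indicator_of_notMem (show s ∉ Set.Ioo 0 (1 / η) from h),
        ENNReal.ofReal_zero]
  simp_rw [hrhs]
  rw [lintegral_indicator measurableSet_Ioo, Measure.restrict_restrict measurableSet_Ioo]
  refine setLIntegral_congr_fun hms fun s hs => ?_
  have h := one_sub_mul_pos hη hs.1.2
  have h0 := hs.1.1
  simp only [hu]
  -- The Jacobian θ / (1 - ηs)² raises the exponents n of θ and of 1 / (1 - ηs) to n + 1 and n + 2.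
  rw [abs_of_pos (by positivity), ← ENNReal.ofReal_mul (by positivity)]
  congr 1
  rw [← mul_assoc]
  congr 1
  rw [div_pow, mul_pow]
  field_simp
  ring

end SINR

end MassiveMIMO

/-! ### Inverse Gram matrices, and those of Gaussian matrices -/

namespace MassiveMIMO

section LinearAlgebra

variable {m κ ι : Type*} [Fintype m] [Fintype κ] [Fintype ι] [DecidableEq κ]

lemma dotProduct_star_self_eq (a : m → ℂ) : a ⬝ᵥ star a = ((∑ i, ‖a i‖ ^ 2 : ℝ) : ℂ) := by
  push_cast
  refine Finset.sum_congr rfl fun i _ => ?_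
  rw [Pi.star_apply, RCLike.star_def, Complex.mul_conj, Complex.normSq_eq_norm_sq]
  push_cast
  rfl

/-- Orthonormal coordinates on the orthogonal complement of linearly independent vectors. -/
lemma exists_orthonormal_compl {o : ι → m → ℂ} (ho : LinearIndependent ℂ o) {r : ℕ}
    (hr : Fintype.card ι + r = Fintype.card m) :
    ∃ u : Fin r → m → ℂ, (∀ i i', u i ⬝ᵥ star (u i') = if i = i' then 1 else 0) ∧
      (∀ i j, u i ⬝ᵥ o j = 0) ∧
      ∀ a : m → ℂ, (∀ j, a ⬝ᵥ star (o j) = 0) → ∑ i, ‖u i ⬝ᵥ a‖ ^ 2 = ∑ i, ‖a i‖ ^ 2 := by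
  classical
  let e := (WithLp.linearEquiv 2 ℂ (m → ℂ)).symm
  have ho' : LinearIndependent ℂ fun j => e (o j) := ho.map' e.toLinearMap e.ker
  set U := (Submodule.span ℂ (Set.range fun j => e (o j)))ᗮ with hU
  have hdim : Module.finrank ℂ U = r := by
    have h1 := Submodule.finrank_add_finrank_orthogonal
      (Submodule.span ℂ (Set.range fun j => e (o j)))
    rw [finrank_span_eq_card ho', finrank_euclideanSpace, ← hU] at h1
    omega
  let b := (stdOrthonormalBasis ℂ U).reindex (finCongr hdim)
  have hmem : ∀ v : EuclideanSpace ℂ m, v ∈ U ↔ ∀ j, inner ℂ (e (o j)) v = 0 := by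
    intro v
    rw [hU, Submodule.mem_orthogonal]
    constructor
    · intro h j
      exact h _ (Submodule.subset_span ⟨j, rfl⟩)
    · intro h x hx
      induction hx using Submodule.span_induction with
      | mem x hx =>
        obtain ⟨j, rfl⟩ := hx
        exact h j
      | zero => simp
      | add x y _ _ hx hy => rw [inner_add_left, hx, hy, add_zero]
      | smul c x _ hx => rw [inner_smul_left, hx, mul_zero]
  have hinner : ∀ i (a : m → ℂ), inner ℂ (b i : EuclideanSpace ℂ m) (e a)
      = star (WithLp.ofLp (b i : EuclideanSpace ℂ m)) ⬝ᵥ a := by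
    intro i a
    rw [EuclideanSpace.inner_eq_star_dotProduct, dotProduct_comm]
    rfl
  -- The dot product is bilinear, so the basis vectors are conjugated to make `u i ⬝ᵥ a` an inner
  -- product. The last property is then Parseval's identity in the complement.
  refine ⟨fun i => star (WithLp.ofLp (b i : EuclideanSpace ℂ m)), ?_, ?_, ?_⟩
  · intro i i'
    rw [star_star]
    have h := (orthonormal_iff_ite.1 b.orthonormal) i i'
    rw [Submodule.coe_inner, EuclideanSpace.inner_eq_star_dotProduct, dotProduct_comm] at h
    exact h
  · intro i j
    rw [← hinner, ← inner_conj_symm, (hmem _).1 (b i).2 j, map_zero]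
  · intro a ha
    have haU : e a ∈ U := by
      rw [hmem]
      intro j
      rw [EuclideanSpace.inner_eq_star_dotProduct]
      exact ha j
    have h := b.sum_sq_norm_inner_right ⟨e a, haU⟩
    have h2 : ‖(⟨e a, haU⟩ : U)‖ ^ 2 = ∑ i, ‖a i‖ ^ 2 := by
      rw [Submodule.coe_norm, EuclideanSpace.norm_sq_eq]
      rfl
    rw [← h2, ← h]
    refine Finset.sum_congr rfl fun i _ => ?_
    rw [← hinner, Submodule.coe_inner]

open scoped ComplexOrder in
-- A†A and A have the same kernel, and linear independence of the columns says that it is trivial.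
lemma isUnit_gram {A : Matrix m κ ℂ} (hA : LinearIndependent ℂ fun j i => A i j) :
    IsUnit (Aᴴ * A) := by
  rw [← Matrix.mulVec_injective_iff_isUnit]
  intro v w hvw
  have h0 : (Aᴴ * A) *ᵥ (v - w) = 0 := by
    rw [Matrix.mulVec_sub]
    exact sub_eq_zero.2 hvw
  rw [Matrix.conjTranspose_mul_self_mulVec_eq_zero] at h0
  have h1 := Fintype.linearIndependent_iff.1 hA (v - w) (by
    rw [← h0]
    ext i
    simp [Matrix.mulVec, dotProduct, mul_comm])
  ext j
  exact sub_eq_zero.1 (h1 j)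

/-- The `k`-th diagonal entry of the inverse Gram matrix is the squared length of the `k`-th
column of the pseudo-inverse. -/
lemma gram_inv_apply_self {A : Matrix m κ ℂ} (hA : IsUnit (Aᴴ * A)) (k : κ) :
    (Aᴴ * A)⁻¹ k k = ((∑ i, ‖(A * (Aᴴ * A)⁻¹) i k‖ ^ 2 : ℝ) : ℂ) := by
  have hdet := (Matrix.isUnit_iff_isUnit_det _).1 hA
  have h : (A * (Aᴴ * A)⁻¹)ᴴ * (A * (Aᴴ * A)⁻¹) = (Aᴴ * A)⁻¹ := by
    rw [Matrix.conjTranspose_mul, Matrix.conjTranspose_nonsing_inv,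
      Matrix.conjTranspose_mul, Matrix.conjTranspose_conjTranspose, Matrix.mul_assoc,
      ← Matrix.mul_assoc Aᴴ, Matrix.mul_nonsing_inv _ hdet, Matrix.mul_one]
  conv_lhs => rw [← h]
  rw [← dotProduct_star_self_eq, dotProduct_comm]
  rfl

/-- Since A† A (A†A)⁻¹ = 1, the columns of the pseudo-inverse form a system biorthogonal to the
columns of A. -/
lemma pseudoInv_orthogonal {A : Matrix m κ ℂ} (hA : IsUnit (Aᴴ * A)) (j k : κ) :
    (fun i => (A * (Aᴴ * A)⁻¹) i k) ⬝ᵥ star (fun i => A i j) = if j = k then 1 else 0 := by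
  have hdet := (Matrix.isUnit_iff_isUnit_det _).1 hA
  have h : Aᴴ * (A * (Aᴴ * A)⁻¹) = 1 := by
    rw [← Matrix.mul_assoc, Matrix.mul_nonsing_inv _ hdet]
  have h1 := congrFun (congrFun h j) k
  rw [Matrix.one_apply] at h1
  rw [← h1, dotProduct_comm]
  rfl

lemma gram_inv_pos {A : Matrix m κ ℂ} (hA : IsUnit (Aᴴ * A)) (k : κ) :
    0 < ∑ i, ‖(A * (Aᴴ * A)⁻¹) i k‖ ^ 2 := by
  refine lt_of_le_of_ne (Finset.sum_nonneg fun i _ => by positivity) fun h => ?_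
  have h0 := (Finset.sum_eq_zero_iff_of_nonneg fun i _ => by positivity).1 h.symm
  have h1 := pseudoInv_orthogonal hA k k
  have h2 : ∀ i, (A * (Aᴴ * A)⁻¹) i k = 0 := fun i => by simpa using h0 i (Finset.mem_univ i)
  simp [h2, dotProduct] at h1

/-- `1 / [(A† A)⁻¹]_kk` is the squared length of the component of the `k`-th column of `A`
orthogonal to the other columns. -/
lemma one_div_gram_inv {A : Matrix m κ ℂ} (hA : IsUnit (Aᴴ * A)) (k : κ) {r : ℕ}
    {u : Fin r → m → ℂ} (hu : ∀ i j, j ≠ k → u i ⬝ᵥ (fun x => A x j) = 0)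
    (hP : ∀ a : m → ℂ, (∀ j, j ≠ k → a ⬝ᵥ star (fun i => A i j) = 0) →
      ∑ i, ‖u i ⬝ᵥ a‖ ^ 2 = ∑ i, ‖a i‖ ^ 2) :
    1 / ((Aᴴ * A)⁻¹ k k).re = ∑ i, ‖u i ⬝ᵥ fun x => A x k‖ ^ 2 := by
  -- By biorthogonality the k-th pseudo-inverse column is orthogonal to every other column of A, so
  -- its squared length b is computed by the coordinates u.
  have h1 := hP (fun i => (A * (Aᴴ * A)⁻¹) i k) fun j hj => by
    rw [pseudoInv_orthogonal hA, if_neg hj]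
  have hpos := gram_inv_pos hA k
  have hB := gram_inv_apply_self hA k
  set b : ℝ := ∑ i, ‖(A * (Aᴴ * A)⁻¹) i k‖ ^ 2 with hb
  -- That column is also a combination of the columns of A, of which u sees only the k-th, with
  -- coefficient b. Hence the squared distance times b² equals b.
  have h2 : ∀ i, u i ⬝ᵥ (fun x => (A * (Aᴴ * A)⁻¹) x k) = (u i ⬝ᵥ fun x => A x k) * b := by
    intro i
    have h3 : u i ⬝ᵥ (fun x => (A * (Aᴴ * A)⁻¹) x k)
        = ∑ j, (u i ⬝ᵥ fun x => A x j) * (Aᴴ * A)⁻¹ j k := by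
      simp only [dotProduct, Matrix.mul_apply, Finset.mul_sum, Finset.sum_mul]
      rw [Finset.sum_comm]
      refine Finset.sum_congr rfl fun j _ => Finset.sum_congr rfl fun x _ => ?_
      ring
    rw [h3, Finset.sum_eq_single k, hB]
    · intro j _ hj
      rw [hu i j hj, zero_mul]
    · simp
  simp only [h2, norm_mul, mul_pow, Complex.norm_real, Real.norm_eq_abs, sq_abs] at h1
  rw [← Finset.sum_mul] at h1
  rw [hB, Complex.ofReal_re, div_eq_iff hpos.ne']
  have : (∑ i, ‖u i ⬝ᵥ fun x => A x k‖ ^ 2) * b * b = 1 * b := by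
    rw [mul_assoc, ← sq, h1, one_mul]
  exact (mul_right_cancel₀ hpos.ne' this).symm

omit [Fintype m] [Fintype κ] [DecidableEq κ] in
lemma linearIndependent_of_others {f : κ → m → ℂ} {k : κ}
    (h : LinearIndependent ℂ fun j : {j // j ≠ k} => f j)
    (hk : f k ∉ Submodule.span ℂ (Set.range fun j : {j // j ≠ k} => f j)) :
    LinearIndependent ℂ f := by
  have h1 : LinearIndepOn ℂ f {j | j ≠ k} := h
  have h2 : f k ∉ Submodule.span ℂ (f '' {j | j ≠ k}) := by
    rw [Set.image_eq_range]
    exact hk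
  have h3 := h1.insert h2
  have h4 : insert k {j | j ≠ k} = (Set.univ : Set κ) := by
    ext j
    simp [em]
  rw [h4] at h3
  exact linearIndepOn_univ_iff.1 h3

end LinearAlgebra

section Freezing

variable {Ω 𝓤 𝓥 𝓦 : Type*} [MeasurableSpace Ω] [MeasurableSpace 𝓤] [MeasurableSpace 𝓥]
  [MeasurableSpace 𝓦] {μ : Measure Ω} [IsProbabilityMeasure μ]

lemma ae_of_indepFun {V : Ω → 𝓥} {U : Ω → 𝓤} (hV : Measurable V) (hU : AEMeasurable U μ)
    (h : IndepFun V U μ) {s : Set (𝓥 × 𝓤)} (hs : MeasurableSet s)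
    (hp : ∀ᵐ ω ∂μ, ∀ᵐ ω' ∂μ, (V ω, U ω') ∈ s) : ∀ᵐ ω ∂μ, (V ω, U ω) ∈ s := by
  have hm : AEMeasurable (fun ω => (V ω, U ω)) μ := hV.aemeasurable.prodMk hU
  have h1 := lintegral_of_indepFun hV hU h (F := sᶜ.indicator fun _ => 1)
    (measurable_const.indicator hs.compl)
  have h2 : ∫⁻ ω, ∫⁻ ω', sᶜ.indicator (fun _ => 1) (V ω, U ω') ∂μ ∂μ = 0 := by
    rw [← lintegral_zero (μ := μ)]
    refine lintegral_congr_ae ?_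
    filter_upwards [hp] with ω hω
    rw [← lintegral_zero (μ := μ)]
    refine lintegral_congr_ae ?_
    filter_upwards [hω] with ω' hω'
    simp [hω']
  have hmi : AEMeasurable (fun ω => sᶜ.indicator (fun _ => (1 : ℝ≥0∞)) (V ω, U ω)) μ :=
    (measurable_const.indicator hs.compl).comp_aemeasurable hm
  rw [h2, lintegral_eq_zero_iff' hmi] at h1
  filter_upwards [h1] with ω hω
  by_contra hc
  simp [hc] at hω

/-- If the law with `V` frozen is the same for almost every value of `V`, averaging over `V` does
not change it. -/
lemma hasLaw_of_indepFun {V : Ω → 𝓥} {U : Ω → 𝓤} (hV : Measurable V) (hU : AEMeasurable U μ)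
    (h : IndepFun V U μ) {f : 𝓥 × 𝓤 → 𝓦} (hf : Measurable f) {ν : Measure 𝓦}
    (hp : ∀ᵐ ω ∂μ, HasLaw (fun ω' => f (V ω, U ω')) ν μ) :
    HasLaw (fun ω => f (V ω, U ω)) ν μ := by
  have hm : AEMeasurable (fun ω => f (V ω, U ω)) μ :=
    hf.comp_aemeasurable (hV.aemeasurable.prodMk hU)
  refine ⟨hm, ?_⟩
  ext B hB
  have h1 := lintegral_of_indepFun hV hU h (F := fun q => B.indicator (fun _ => 1) (f q))
    ((measurable_const.indicator hB).comp hf)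
  have h2 : ∫⁻ ω, ∫⁻ ω', B.indicator (fun _ => (1 : ℝ≥0∞)) (f (V ω, U ω')) ∂μ ∂μ
      = ∫⁻ _, ν B ∂μ := by
    refine lintegral_congr_ae ?_
    filter_upwards [hp] with ω hω
    rw [← hω.map_eq, ← lintegral_map' (f := B.indicator fun _ => 1)
      (measurable_const.indicator hB).aemeasurable hω.aemeasurable]
    simp [lintegral_indicator hB]
  rw [h2, ← lintegral_map' (f := B.indicator fun _ => 1)
      (measurable_const.indicator hB).aemeasurable hm] at h1
  simpa [lintegral_indicator hB] using h1

end Freezing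

section RandomMatrix

variable {m κ ι Ω : Type*} [Fintype m] [Fintype κ] [Fintype ι] [MeasurableSpace Ω]
  {μ : Measure Ω} [IsProbabilityMeasure μ]

omit [IsProbabilityMeasure μ] in
lemma ae_pos_of_hasLaw_erlangMeasure {T : Ω → ℝ} {n : ℕ} (hT : HasLaw T (erlangMeasure n) μ) :
    ∀ᵐ ω ∂μ, 0 < T ω := by
  rw [hT.ae_iff (p := fun x => 0 < x) (measurableSet_lt measurable_const measurable_id).mem]
  refine (withDensity_absolutelyContinuous _ _).ae_le ?_
  exact (ae_restrict_iff' measurableSet_Ioi).2 (Filter.Eventually.of_forall fun x hx => hx)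

/-- A Gaussian vector avoids a given proper subspace. -/
lemma ae_notMem_span {g : Ω → m → ℂ} (hg : HasLaw g (gaussVec m) μ) {o : ι → m → ℂ}
    (ho : LinearIndependent ℂ o) (hc : Fintype.card ι < Fintype.card m) :
    ∀ᵐ ω ∂μ, g ω ∉ Submodule.span ℂ (Set.range o) := by
  obtain ⟨n, hn⟩ := Nat.exists_eq_add_of_lt hc
  obtain ⟨u, hu1, hu2, -⟩ := exists_orthonormal_compl ho (r := n + 1) (by omega)
  -- The squared distance from the subspace has an Erlang law, which does not charge 0; on the
  -- subspace it would be 0.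
  have h := hasLaw_sum_norm_sq (hasLaw_dotProduct hg u hu1) (n := n) (by simp)
  filter_upwards [ae_pos_of_hasLaw_erlangMeasure h] with ω hω hmem
  have h0 : ∀ i, u i ⬝ᵥ g ω = 0 := by
    intro i
    generalize g ω = y at hmem
    induction hmem using Submodule.span_induction with
    | mem x hx =>
      obtain ⟨j, rfl⟩ := hx
      exact hu2 i j
    | zero => simp
    | add x y _ _ hx hy => rw [dotProduct_add, hx, hy, add_zero]
    | smul c x _ hx => rw [dotProduct_smul, hx, smul_zero]
  simp [h0] at hω

variable [DecidableEq m] [DecidableEq κ]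

lemma hasLaw_submatrix {J J' : Type*} [Fintype J] [Fintype J'] {Z : Ω → J → ℂ}
    (hZ : HasLaw Z (gaussVec J) μ) {e : J' → J} (he : Function.Injective e) :
    HasLaw (fun ω j => Z ω (e j)) (gaussVec J') μ := by
  classical
  have h := hasLaw_dotProduct hZ (fun j => Pi.single (e j) 1) fun i i' => by
    rw [Params.single_dotProduct_star_single]
    simp [he.eq_iff]
  simpa using h

/-- A column of a Gaussian matrix is independent of other columns. -/
lemma indepFun_columns {W : Ω → m → κ → ℂ}
    (hW : HasLaw (fun ω (q : m × κ) => W ω q.1 q.2) (gaussVec (m × κ)) μ) (k : κ) {e : ι → κ}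
    (he : ∀ j, e j ≠ k) :
    IndepFun (fun ω j i => W ω i (e j)) (fun ω i => W ω i k) μ := by
  have h := indepFun_dotProduct hW (fun q : ι × m => Pi.single (q.2, e q.1) 1)
    (fun i : m => Pi.single (i, k) 1) fun q i => by
      rw [Params.single_dotProduct_star_single]
      simp [he]
  simp only [single_one_dotProduct] at h
  have h1 : Measurable fun (f : ι × m → ℂ) j i => f (j, i) := by fun_prop
  exact h.comp h1 measurable_id

omit [DecidableEq m] in
lemma measurableSet_linearIndependent :
    MeasurableSet {f : ι → m → ℂ | LinearIndependent ℂ f} :=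
  (isOpen_setOfPred_linearIndependent (𝕜 := ℂ) (E := m → ℂ) (ι := ι)).measurableSet

/-- The columns of a tall Gaussian matrix are almost surely linearly independent. -/
theorem ae_linearIndependent_fin {n : ℕ} (hn : n ≤ Fintype.card m) {W : Ω → m → Fin n → ℂ}
    (hmW : Measurable W)
    (hW : HasLaw (fun ω (q : m × Fin n) => W ω q.1 q.2) (gaussVec (m × Fin n)) μ) :
    ∀ᵐ ω ∂μ, LinearIndependent ℂ fun j i => W ω i j := by
  induction n with
  | zero => exact Filter.Eventually.of_forall fun ω => linearIndependent_empty_type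
  | succ n ih =>
    have h1 := ih (by omega) (W := fun ω i j => W ω i j.succ) (by fun_prop)
      (hasLaw_submatrix hW (e := fun q : m × Fin n => (q.1, q.2.succ)) fun a b h => by
        simpa [Prod.ext_iff] using h)
    have h2 := indepFun_columns hW 0 (e := Fin.succ) fun j => Fin.succ_ne_zero j
    have hg : HasLaw (fun ω i => W ω i 0) (gaussVec m) μ :=
      hasLaw_submatrix hW (e := fun i : m => (i, (0 : Fin (n + 1)))) fun a b h => by
        simpa using h
    have hcons : Measurable fun q : (Fin n → m → ℂ) × (m → ℂ) =>
        (Fin.cons q.2 q.1 : Fin (n + 1) → m → ℂ) := by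
      refine measurable_pi_iff.2 fun j => ?_
      refine Fin.cases ?_ (fun j => ?_) j
      · simpa using measurable_snd
      · simp only [Fin.cons_succ]
        fun_prop
    -- The last n columns, independent by induction, are frozen; column 0 is independent of them and
    -- avoids their span.
    have h3 := ae_of_indepFun (by fun_prop) hg.aemeasurable h2
      (hcons measurableSet_linearIndependent) (by
        filter_upwards [h1] with ω hω
        filter_upwards [ae_notMem_span hg hω (by simpa using hn)] with ω' hω'
        exact linearIndependent_finCons.2 ⟨hω, hω'⟩)
    filter_upwards [h3] with ω hω
    have h4 : (fun j i => W ω i j)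
        = (Fin.cons (fun i => W ω i 0) fun j i => W ω i j.succ : Fin (n + 1) → m → ℂ) := by
      ext j i
      refine Fin.cases ?_ (fun j => ?_) j <;> simp
    rw [h4]
    exact hω

omit [DecidableEq κ] in
theorem ae_linearIndependent (hc : Fintype.card κ ≤ Fintype.card m) {W : Ω → m → κ → ℂ}
    (hmW : Measurable W)
    (hW : HasLaw (fun ω (q : m × κ) => W ω q.1 q.2) (gaussVec (m × κ)) μ) :
    ∀ᵐ ω ∂μ, LinearIndependent ℂ fun j i => W ω i j := by
  let e := (Fintype.equivFin κ).symm
  have h := ae_linearIndependent_fin hc (W := fun ω i j => W ω i (e j)) (by fun_prop)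
    (hasLaw_submatrix hW (e := fun q : m × Fin (Fintype.card κ) => (q.1, e q.2)) fun a b h => by
      simpa [Prod.ext_iff] using h)
  filter_upwards [h] with ω hω
  exact (linearIndependent_equiv e).1 hω

omit [DecidableEq m] in
-- The inverse is not continuous at singular matrices, but it is the adjugate times the inverted
-- determinant, both measurable.
lemma measurable_gram_inv (k l : κ) :
    Measurable fun A : m → κ → ℂ => (((Matrix.of A)ᴴ * Matrix.of A)⁻¹) k l := by
  have hc : Continuous fun A : m → κ → ℂ => (Matrix.of A)ᴴ * Matrix.of A := by
    have : Continuous fun A : m → κ → ℂ => Matrix.of A := continuous_id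
    fun_prop
  have h1 : Measurable fun A : m → κ → ℂ => ((Matrix.of A)ᴴ * Matrix.of A).det :=
    hc.matrix_det.measurable
  have h2 : Measurable fun A : m → κ → ℂ => ((Matrix.of A)ᴴ * Matrix.of A).adjugate k l :=
    (hc.matrix_adjugate.matrix_elem k l).measurable
  simp only [Matrix.inv_def, Matrix.smul_apply, Ring.inverse_eq_inv', smul_eq_mul]
  exact h1.inv.mul h2

/-- For a Gaussian matrix `W` with `M` rows and `K ≤ M` columns, `1 / [(W† W)⁻¹]_kk` is a sum of
`M - K + 1` independent exponential variables. -/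
theorem hasLaw_one_div_gram_inv (hc : Fintype.card κ ≤ Fintype.card m) {W : Ω → m → κ → ℂ}
    (hmW : Measurable W)
    (hW : HasLaw (fun ω (q : m × κ) => W ω q.1 q.2) (gaussVec (m × κ)) μ) (k : κ) :
    HasLaw (fun ω => 1 / ((((Matrix.of (W ω))ᴴ * Matrix.of (W ω))⁻¹) k k).re)
      (erlangMeasure (Fintype.card m - Fintype.card κ)) μ := by
  have hI := indepFun_columns hW k (e := fun j : {j // j ≠ k} => (j : κ)) fun j => j.2
  have hg : HasLaw (fun ω i => W ω i k) (gaussVec m) μ :=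
    hasLaw_submatrix hW (e := fun i : m => (i, k)) fun a b h => by simpa using h
  -- Rebuilds the matrix from its frozen columns and its k-th column, so that the two can be
  -- evaluated at different outcomes.
  let asm : ({j // j ≠ k} → m → ℂ) × (m → ℂ) → m → κ → ℂ :=
    fun q i j => if h : j = k then q.2 i else q.1 ⟨j, h⟩ i
  have hasm : Measurable asm := by
    refine measurable_pi_iff.2 fun i => measurable_pi_iff.2 fun j => ?_
    by_cases h : j = k
    · simp only [asm, h, dite_true]
      fun_prop
    · simp only [asm, h, dite_false]
      fun_prop
  have hcard : Fintype.card {j // j ≠ k} + 1 = Fintype.card κ := by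
    have : 0 < Fintype.card κ := Fintype.card_pos_iff.2 ⟨k⟩
    rw [Fintype.card_subtype_compl, Fintype.card_subtype_eq]
    omega
  have hasm_k : ∀ q i, asm q i k = q.2 i := fun q i => by simp [asm]
  have hasm_ne : ∀ q i (j : {j // j ≠ k}), asm q i j = q.1 j i := fun q i j => by
    simp [asm, j.2]
  have key := hasLaw_of_indepFun (by fun_prop) hg.aemeasurable hI
    (f := fun q => 1 / ((((Matrix.of (asm q))ᴴ * Matrix.of (asm q))⁻¹) k k).re)
    (ν := erlangMeasure (Fintype.card m - Fintype.card κ))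
    (measurable_const.div (Complex.measurable_re.comp ((measurable_gram_inv k k).comp hasm))) ?_
  · convert key using 7 with ω
    all_goals
    · ext i j
      by_cases h : j = k
      · subst h
        simp [asm]
      · simp [asm, h]
  · filter_upwards [ae_linearIndependent hc hmW hW] with ω hω
    have ho : LinearIndependent ℂ fun (j : {j // j ≠ k}) i => W ω i j :=
      hω.comp _ Subtype.val_injective
    -- The complement of the other K - 1 columns has dimension M - (K - 1), hence M - K + 1 squared
    -- Gaussian coordinates.
    obtain ⟨u, hu1, hu2, hu3⟩ := exists_orthonormal_compl ho
      (r := Fintype.card m - Fintype.card κ + 1) (by omega)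
    refine (hasLaw_sum_norm_sq (hasLaw_dotProduct hg u hu1) (by simp)).congr ?_
    filter_upwards [ae_notMem_span hg ho (by omega)] with ω' hω'
    set q : ({j // j ≠ k} → m → ℂ) × (m → ℂ) := (fun j i => W ω i j, fun i => W ω' i k) with hq
    have hLI : LinearIndependent ℂ fun j i => Matrix.of (asm q) i j := by
      refine linearIndependent_of_others (k := k) ?_ ?_
      · simpa only [Matrix.of_apply, hasm_ne] using ho
      · simpa only [Matrix.of_apply, hasm_ne, hasm_k] using hω'
    have h := one_div_gram_inv (isUnit_gram hLI) k (u := u)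
      (fun i j hj => by
        have := hu2 i ⟨j, hj⟩
        simpa only [Matrix.of_apply, hasm_ne q _ ⟨j, hj⟩] using this)
      (fun a ha => hu3 a fun j => by
        have := ha j j.2
        simpa only [Matrix.of_apply, hasm_ne] using this)
    simp only [Matrix.of_apply, hasm_k] at h
    exact h

end RandomMatrix

end MassiveMIMO

/-! ### The SINR after zero forcing and its law -/

namespace MassiveMIMO

variable {L M K τ : ℕ}

namespace Params

variable (p : Params L M K τ)

include p in
-- A pilot of unit length cannot have zero symbols. Without this, τP could vanish in the denominator
-- of `βhat`.
lemma tau_pos (k : Fin K) : 0 < τ := by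
  rcases Nat.eq_zero_or_pos τ with h | h
  · subst h
    have h1 := p.sum_pilot k k
    simp at h1
  · exact h

lemma tauP_pos (k : Fin K) : 0 < (τ : ℝ) * p.P :=
  mul_pos (by exact_mod_cast p.tau_pos k) p.P_pos

lemma gain_pos (i : Fin L) (k : Fin K) : 0 < p.gain i k :=
  div_pos (mul_pos (Real.sqrt_pos.2 (p.tauP_pos k)) (p.β_pos i k)) (p.pilotVar_pos k)

/-- The variance of an entry of the `k`-th column of `Ĝ_ℓ`. -/
def estVar (k : Fin K) : ℝ := p.gain p.ℓ k ^ 2 * p.pilotVar k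

lemma estVar_pos (k : Fin K) : 0 < p.estVar k :=
  mul_pos (pow_pos (p.gain_pos _ k) 2) (p.pilotVar_pos k)

/-- The variance of an entry of the estimate is β_{ℓ,k}² / β̂_k, so rescaling X to unit variance
turns θ into the normalised constant. -/
lemma θnorm_eq (k : Fin K) : p.θnorm k = p.θ / p.estVar k := by
  have h1 := (p.tauP_pos k).ne'
  have h2 := (p.pilotVar_pos k).ne'
  have h3 := (p.β_pos p.ℓ k).ne'
  have h4 : p.estVar k = τ * p.P * p.β p.ℓ k ^ 2 / p.pilotVar k := by
    unfold estVar gain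
    rw [div_pow, mul_pow, Real.sq_sqrt p.tauP_nonneg]
    field_simp
  have h5 : p.βhat k = p.pilotVar k / (τ * p.P) := by
    unfold βhat pilotVar
    rw [eq_div_iff h1, add_mul, one_div_mul_cancel h1, mul_comm]
  unfold θnorm
  rw [h4, h5]
  field_simp

lemma errVar_nonneg (i : Fin L) (k : Fin K) : 0 ≤ p.errVar i k := by
  have h1 := p.tauP_nonneg
  have h2 := p.pilotVar_pos k
  have h3 : 0 ≤ ∑ j ∈ Finset.univ.erase i, p.β j k :=
    Finset.sum_nonneg fun j _ => (p.β_pos j k).le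
  have h4 := p.β_pos i k
  unfold errVar
  positivity

lemma α_nonneg (i : Fin L) : 0 ≤ p.α i := by
  rw [α_eq_sum_errVar]
  exact Finset.sum_nonneg fun k _ => p.errVar_nonneg i k

lemma θ_pos : 0 < p.θ := by
  have h1 : 0 ≤ ∑ i, p.α i := Finset.sum_nonneg fun i _ => p.α_nonneg i
  have h2 : 0 < 1 / p.P := one_div_pos.2 p.P_pos
  unfold θ
  linarith

lemma θnorm_pos (k : Fin K) : 0 < p.θnorm k := by
  rw [θnorm_eq]
  exact div_pos p.θ_pos (p.estVar_pos k)

lemma η_pos (hL : 1 < L) (k : Fin K) : 0 < p.η k := by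
  refine div_pos (Finset.sum_pos (fun i _ => pow_pos (p.β_pos i k) 2) ?_) (pow_pos (p.β_pos _ k) 2)
  rw [← Finset.card_pos, Finset.card_erase_of_mem (Finset.mem_univ _), Finset.card_univ,
    Fintype.card_fin]
  omega

lemma η_eq_sum (k : Fin K) :
    p.η k = ∑ i ∈ Finset.univ.erase p.ℓ, ‖((p.β i k / p.β p.ℓ k : ℝ) : ℂ)‖ ^ 2 := by
  unfold η
  rw [Finset.sum_div]
  refine Finset.sum_congr rfl fun i _ => ?_
  rw [Complex.norm_real, Real.norm_eq_abs, sq_abs, div_pow]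

/-- Errors at different antennas are uncorrelated with equal variances, so a combination of them
depends on `c` only through its length. -/
lemma dotProduct_star_sum_coefξ (i : Fin L) (j : Fin K) (c : Fin M → ℂ) :
    (∑ m, c m • p.coefξ i m j) ⬝ᵥ star (∑ m, c m • p.coefξ i m j)
      = ((p.errVar i j * ∑ m, ‖c m‖ ^ 2 : ℝ) : ℂ) := by
  simp only [star_sum, star_smul, sum_dotProduct, dotProduct_sum, smul_dotProduct,
    dotProduct_smul, cov_ξ_ξ]
  have h := dotProduct_star_self_eq c
  push_cast at h ⊢
  rw [← h]
  simp only [dotProduct, Finset.mul_sum, and_true, smul_eq_mul]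
  refine Finset.sum_congr rfl fun m _ => ?_
  simp
  ring

end Params

/-- The zero-forcing receiver as a function of the estimate. -/
def zf (g : Fin M → Fin K → ℂ) : Matrix (Fin M) (Fin K) ℂ :=
  Matrix.of g * ((Matrix.of g)ᴴ * Matrix.of g)⁻¹

lemma measurable_zf (m : Fin M) (k : Fin K) :
    Measurable fun g : Fin M → Fin K → ℂ => zf g m k := by
  have h0 : (fun g : Fin M → Fin K → ℂ => zf g m k)
      = fun g => ∑ j, g m j * ((Matrix.of g)ᴴ * Matrix.of g)⁻¹ j k := by
    ext g
    rw [zf, Matrix.mul_apply]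
    rfl
  rw [h0]
  refine Finset.measurable_fun_sum _ fun j _ => Measurable.mul ?_ (measurable_gram_inv j k)
  exact (measurable_pi_apply j).comp (measurable_pi_apply m)

lemma measurable_star_zf (m : Fin M) (k : Fin K) :
    Measurable fun g : Fin M → Fin K → ℂ => star (zf g m k) :=
  continuous_star.measurable.comp (measurable_zf m k)

namespace Signals

variable {Ω : Type*} [MeasurableSpace Ω] {μ : Measure Ω}
variable (S : Signals L M K τ μ) (p : Params L M K τ)

lemma indepFun_x_gauss : IndepFun (fun ω i k => S.x i ω k) S.gauss μ := by
  let T : (Fin L → Fin M → Fin K → ℂ) × (Fin M → Fin τ → ℂ) × (Fin M → ℂ) →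
      GaussIndex L M K τ → ℂ := fun q j =>
    match j with
    | .inl (.inl (i, m, k)) => q.1 i m k
    | .inl (.inr (m, t)) => q.2.1 m t
    | .inr m => q.2.2 m
  have hT : Measurable T := by
    refine measurable_pi_iff.2 ?_
    rintro ((⟨i, m, k⟩ | ⟨m, t⟩) | m) <;> simp only [T] <;> fun_prop
  have h := S.indep_data.comp measurable_id hT
  convert! h using 1

lemma measurable_data (i : Fin L) : Measurable (S.x i) :=
  measurable_pi_iff.2 fun k => S.measurable_x i k

lemma indepFun_ξ_x (i i' : Fin L) : IndepFun (fun ω m k => S.ξ p i ω m k) (S.x i') μ := by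
  have h1 : Measurable fun (z : GaussIndex L M K τ → ℂ) m k => p.coefξ i m k ⬝ᵥ z := by
    unfold dotProduct
    fun_prop
  have h2 : Measurable fun (x : Fin L → Fin K → ℂ) => x i' := by fun_prop
  have h := (S.indepFun_x_gauss.comp h2 h1).symm
  simp only [ξ_eq]
  exact h

variable [IsProbabilityMeasure μ]

/-- This is what permits freezing Ĝ in the conditional expectations: Ĝ is a function of Y, of which
the error is independent, and the data are independent of both. -/
lemma indepFun_Ghat_ξ_x (i : Fin L) :
    IndepFun (fun ω m k => S.Ghat p p.ℓ ω m k) (fun ω => (fun m k => S.ξ p i ω m k, S.x i ω)) μ := by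
  have h1 : Measurable fun (z : GaussIndex L M K τ → ℂ) =>
      ((fun m k => p.gain p.ℓ k * (p.coefW m k ⬝ᵥ z), fun m k => p.coefξ i m k ⬝ᵥ z) :
        (Fin M → Fin K → ℂ) × (Fin M → Fin K → ℂ)) := by
    unfold dotProduct
    fun_prop
  have h2 : Measurable fun (x : Fin L → Fin K → ℂ) => x i := by fun_prop
  have h := S.indepFun_x_gauss.comp h2 h1
  have h3 : Measurable fun (y : Fin M → Fin τ → ℂ) m k =>
      (p.gain p.ℓ k : ℂ) * ∑ t, y m t * star (p.Ψ t k) := by fun_prop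
  have h4 := ((S.indepFun_ξ_pilotY p i).comp measurable_id h3).symm
  refine indepFun_prodMk_of_indepFun (S.measurable_Ghat p p.ℓ).aemeasurable
    (S.measurable_ξ p i).aemeasurable (S.measurable_data i).aemeasurable ?_ ?_
  · convert! h4 using 1
    ext ω m k
    simp [Ghat_eq, pilotProj, Matrix.mul_apply]
  · simp only [Ghat_eq, pilotProj_eq, ξ_eq]
    exact h

lemma indepFun_Ghat_noise : IndepFun (fun ω m k => S.Ghat p p.ℓ ω m k) S.n μ := by
  have h := indepFun_dotProduct S.hasLaw_gauss (fun m : Fin M => Pi.single (.inr m) 1)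
    (fun q : Fin M × Fin K => p.coefW q.1 q.2) fun m q => p.cov_noise_W m q.1 q.2
  have h1 : Measurable fun (w : Fin M × Fin K → ℂ) m k => (p.gain p.ℓ k : ℂ) * w (m, k) := by
    fun_prop
  have h2 := (h.comp measurable_id h1).symm
  simp only [single_one_dotProduct] at h2
  simp only [Ghat_eq, pilotProj_eq]
  exact h2

lemma zf_conjTranspose_mul {g : Fin M → Fin K → ℂ}
    (hg : IsUnit ((Matrix.of g)ᴴ * Matrix.of g)) : (zf g)ᴴ * Matrix.of g = 1 := by
  have hdet := (Matrix.isUnit_iff_isUnit_det _).1 hg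
  have h : (Matrix.of g)ᴴ * zf g = 1 := by
    rw [zf, ← Matrix.mul_assoc, Matrix.mul_nonsing_inv _ hdet]
  rw [← Matrix.conjTranspose_conjTranspose (Matrix.of g), ← Matrix.conjTranspose_mul, h,
    Matrix.conjTranspose_one]

/-- The output of the zero-forcing receiver for a channel `ξ + g D` and the data `x`. -/
def zfOutput (d : Fin K → ℂ) (k : Fin K)
    (q : (Fin M → Fin K → ℂ) × (Fin M → Fin K → ℂ) × (Fin K → ℂ)) : ℂ :=
  ((zf q.1)ᴴ *ᵥ ((Matrix.of q.2.1 + Matrix.of q.1 * Matrix.diagonal d) *ᵥ q.2.2)) k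

lemma measurable_zfOutput (d : Fin K → ℂ) (k : Fin K) :
    Measurable (zfOutput (M := M) d k) := by
  unfold zfOutput
  simp only [Matrix.mulVec, dotProduct, Matrix.conjTranspose_apply, Matrix.add_apply,
    Matrix.mul_diagonal, Matrix.of_apply]
  have h2 : ∀ m k, Measurable fun q : (Fin M → Fin K → ℂ) × (Fin M → Fin K → ℂ) × (Fin K → ℂ) =>
      star (zf q.1 m k) := fun m k => (measurable_star_zf m k).comp measurable_fst
  fun_prop

/-- The receiver is a left inverse of `g`, so `g D` contributes just `D`, whose k-th row has the
single entry `d k`. -/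
lemma zfOutput_eq (d : Fin K → ℂ) (k : Fin K) {g : Fin M → Fin K → ℂ}
    (hg : IsUnit ((Matrix.of g)ᴴ * Matrix.of g)) (e : Fin M → Fin K → ℂ) (x : Fin K → ℂ) :
    zfOutput d k (g, e, x)
      = (fun j => (if k = j then d j else 0) + ∑ m, star (zf g m k) * e m j) ⬝ᵥ x := by
  unfold zfOutput
  simp only
  rw [Matrix.mulVec_mulVec, Matrix.mul_add, ← Matrix.mul_assoc, zf_conjTranspose_mul hg,
    Matrix.one_mul, Matrix.mulVec]
  congr 1
  ext j
  rw [Matrix.add_apply, Matrix.diagonal_apply, add_comm, Matrix.mul_apply]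
  congr 1
  by_cases h : k = j
  · simp [h]
  · simp [h]

/-- The mean power of the output of the zero-forcing receiver for a frozen estimate. -/
lemma lintegral_zfOutput (i : Fin L) (d : Fin K → ℂ) (k : Fin K) {g : Fin M → Fin K → ℂ}
    (hg : IsUnit ((Matrix.of g)ᴴ * Matrix.of g)) :
    ∫⁻ ω, ‖zfOutput d k (g, fun m j => S.ξ p i ω m j, S.x i ω)‖ₑ ^ 2 ∂μ
      = ENNReal.ofReal (‖d k‖ ^ 2 + p.α i * ∑ m, ‖zf g m k‖ ^ 2) := by
  have hF : Measurable fun q : (Fin M → Fin K → ℂ) × (Fin K → ℂ) =>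
      ‖zfOutput d k (g, q.1, q.2)‖ₑ ^ 2 :=
    ((measurable_zfOutput d k).comp (by fun_prop)).enorm.pow_const 2
  -- Average over the data first, with the error frozen: E[xx†] = I turns the power into the squared
  -- length of the row, which is then averaged over the Gaussian error.
  rw [lintegral_of_indepFun (S.measurable_ξ p i) (S.measurable_data i).aemeasurable
    (S.indepFun_ξ_x p i i) hF]
  have h1 : ∀ ω j, (if k = j then d j else 0) + ∑ m, star (zf g m k) * S.ξ p i ω m j
      = (if k = j then d j else 0) + (∑ m, star (zf g m k) • p.coefξ i m j) ⬝ᵥ S.gauss ω := by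
    intro ω j
    simp only [ξ_eq, sum_dotProduct, smul_dotProduct, smul_eq_mul]
  have h2 : ∀ ω, ∫⁻ ω', ‖zfOutput d k (g, fun m j => S.ξ p i ω m j, S.x i ω')‖ₑ ^ 2 ∂μ
      = ∑ j, ‖(if k = j then d j else 0)
        + (∑ m, star (zf g m k) • p.coefξ i m j) ⬝ᵥ S.gauss ω‖ₑ ^ 2 := by
    intro ω
    simp only [zfOutput_eq d k hg, h1]
    rw [lintegral_enorm_dotProduct_sq (U := fun j ω => S.x i ω j) (S.memLp_x i)
      (S.covariance_x i), ENNReal.ofReal_sum_of_nonneg fun j _ => by positivity]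
    refine Finset.sum_congr rfl fun j _ => ?_
    rw [ENNReal.ofReal_pow (norm_nonneg _), ofReal_norm]
  simp_rw [h2]
  have hmg := S.measurable_dotProduct_gauss
  rw [lintegral_finsetSum _ fun j _ => by fun_prop]
  have h3 : ∀ j, ∑ x, ‖(∑ m, star (zf g m k) • p.coefξ i m j) x‖ ^ 2
      = p.errVar i j * ∑ m, ‖zf g m k‖ ^ 2 := by
    intro j
    have h4 := p.dotProduct_star_sum_coefξ i j fun m => star (zf g m k)
    rw [dotProduct_star_self_eq] at h4
    simpa using Complex.ofReal_injective h4
  simp_rw [lintegral_enorm_const_add_dotProduct_sq S.hasLaw_gauss, h3]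
  rw [← ENNReal.ofReal_sum_of_nonneg]
  · congr 1
    rw [Finset.sum_add_distrib, ← Finset.sum_mul, ← Params.α_eq_sum_errVar]
    congr 1
    rw [Finset.sum_eq_single k] <;> simp +contextual [eq_comm]
  · intro j _
    have := p.errVar_nonneg i j
    positivity

lemma lintegral_zf_noise (k : Fin K) (g : Fin M → Fin K → ℂ) :
    ∫⁻ ω, ‖((zf g)ᴴ *ᵥ S.n ω) k‖ₑ ^ 2 ∂μ = ENNReal.ofReal (∑ m, ‖zf g m k‖ ^ 2) := by
  have h := lintegral_enorm_const_add_dotProduct_sq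
    (hasLaw_submatrix S.hasLaw_gauss (e := fun m : Fin M => .inr m) fun a b h => by simpa using h)
    0 fun m => star (zf g m k)
  simpa [zero_add, Matrix.mulVec, gauss] using h

omit [IsProbabilityMeasure μ] in
lemma detect_eq (k : Fin K) (ω : Ω) (v : Fin M → ℂ) :
    S.detect p k ω v = ((zf fun m j => S.Ghat p p.ℓ ω m j)ᴴ *ᵥ v) k := rfl

omit [IsProbabilityMeasure μ] in
-- Pilot contamination: all estimates are scalings of the same projected pilots. The ratios of the β
-- become the interference η that no increase of X removes.
lemma Ghat_eq_mul_diagonal (i : Fin L) (ω : Ω) :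
    S.Ghat p i ω = S.Ghat p p.ℓ ω * Matrix.diagonal fun j =>
      ((p.β i j / p.β p.ℓ j : ℝ) : ℂ) := by
  ext m j
  rw [Matrix.mul_diagonal, Ghat_eq, Ghat_eq]
  have h : p.gain i j = p.gain p.ℓ j * (p.β i j / p.β p.ℓ j) := by
    have := (p.β_pos p.ℓ j).ne'
    unfold Params.gain
    field_simp
  rw [h]
  push_cast
  ring

/-- The projected pilots, normalised to unit variance. -/
def pilotNormed (ω : Ω) (m : Fin M) (k : Fin K) : ℂ :=
  ((Real.sqrt (p.pilotVar k))⁻¹ : ℝ) * S.pilotProj p ω m k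

omit [IsProbabilityMeasure μ] in
lemma measurable_pilotNormed : Measurable (S.pilotNormed p) := by
  have h : ∀ m k, Measurable fun ω => S.pilotProj p ω m k := fun m k => by
    simp only [pilotProj_eq]
    exact S.measurable_dotProduct_gauss _
  unfold pilotNormed
  fun_prop

lemma hasLaw_pilotNormed :
    HasLaw (fun ω (q : Fin M × Fin K) => S.pilotNormed p ω q.1 q.2)
      (gaussVec (Fin M × Fin K)) μ := by
  have h := hasLaw_dotProduct S.hasLaw_gauss (fun q : Fin M × Fin K =>
    (((Real.sqrt (p.pilotVar q.2))⁻¹ : ℝ) : ℂ) • p.coefW q.1 q.2) fun q q' => by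
      rw [star_smul, smul_dotProduct, dotProduct_smul, Params.cov_W_W]
      by_cases hq : q = q'
      · subst hq
        simp only [and_self, if_true, RCLike.star_def, Complex.conj_ofReal, smul_eq_mul]
        rw [← Complex.ofReal_mul, ← Complex.ofReal_mul]
        have h1 := p.pilotVar_pos q.2
        have h2 := Real.sqrt_pos.2 h1
        have h3 := Real.mul_self_sqrt h1.le
        rw [← Complex.ofReal_one]
        congr 1
        rw [inv_mul_eq_div, inv_mul_eq_div, div_div, h3, div_self h1.ne']
      · have : ¬ (q.1 = q'.1 ∧ q.2 = q'.2) := fun h => hq (Prod.ext h.1 h.2)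
        simp [hq, this]
  simp only [smul_dotProduct, ← pilotProj_eq, smul_eq_mul] at h
  exact h

omit [IsProbabilityMeasure μ] in
lemma Ghat_eq_pilotNormed_mul (ω : Ω) :
    S.Ghat p p.ℓ ω = Matrix.of (S.pilotNormed p ω) * Matrix.diagonal fun k =>
      ((p.gain p.ℓ k * Real.sqrt (p.pilotVar k) : ℝ) : ℂ) := by
  ext m k
  have h1 : ((Real.sqrt (p.pilotVar k) : ℝ) : ℂ) ≠ 0 := by
    exact_mod_cast (Real.sqrt_pos.2 (p.pilotVar_pos k)).ne'
  rw [Matrix.mul_diagonal, Matrix.of_apply, pilotNormed, Ghat_eq]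
  push_cast
  field_simp

omit [IsProbabilityMeasure μ] in
-- Scaling the columns of W by a diagonal C turns (W†W)⁻¹ into C⁻¹ (W†W)⁻¹ C⁻¹, so the reciprocal
-- diagonal entry is multiplied by c_k².
lemma X_eq (k : Fin K) (ω : Ω) :
    S.X p k ω = p.estVar k * (1 / ((((Matrix.of (S.pilotNormed p ω))ᴴ
      * Matrix.of (S.pilotNormed p ω))⁻¹) k k).re) := by
  set W : Matrix (Fin M) (Fin K) ℂ := Matrix.of (S.pilotNormed p ω)
  set c : Fin K → ℝ := fun k => p.gain p.ℓ k * Real.sqrt (p.pilotVar k) with hc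
  have hc0 : ∀ k, c k ≠ 0 := fun k =>
    (mul_pos (p.gain_pos _ k) (Real.sqrt_pos.2 (p.pilotVar_pos k))).ne'
  have hG : S.Ghat p p.ℓ ω = W * Matrix.diagonal fun k => (c k : ℂ) :=
    S.Ghat_eq_pilotNormed_mul p ω
  have hstar : (Matrix.diagonal fun k => (c k : ℂ))ᴴ = Matrix.diagonal fun k => (c k : ℂ) := by
    rw [Matrix.diagonal_conjTranspose]
    congr 1
    ext k
    simp
  have hinv : (Matrix.diagonal fun k => (c k : ℂ))⁻¹ = Matrix.diagonal fun k => ((c k : ℂ))⁻¹ := by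
    refine Matrix.inv_eq_right_inv ?_
    rw [Matrix.diagonal_mul_diagonal, ← Matrix.diagonal_one]
    congr 1
    ext k
    exact mul_inv_cancel₀ (by exact_mod_cast hc0 k)
  have hv : p.estVar k = c k ^ 2 := by
    rw [hc]
    simp only
    rw [mul_pow, Real.sq_sqrt (p.pilotVar_pos k).le]
    rfl
  rw [X, hG, Matrix.conjTranspose_mul, hstar, Matrix.mul_assoc, ← Matrix.mul_assoc Wᴴ,
    Matrix.mul_inv_rev, Matrix.mul_inv_rev, hinv, Matrix.mul_diagonal, Matrix.diagonal_mul, hv,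
    ← Complex.ofReal_inv, mul_right_comm, ← Complex.ofReal_mul, Complex.re_ofReal_mul]
  have := hc0 k
  rw [← sq, inv_pow, one_div, mul_inv, inv_inv, one_div]

/-- `X` in units of the variance of the estimate has an Erlang law. -/
lemma hasLaw_X_div (hKM : K ≤ M) (k : Fin K) :
    HasLaw (fun ω => S.X p k ω / p.estVar k) (erlangMeasure (M - K)) μ := by
  have h := hasLaw_one_div_gram_inv (by simpa using hKM) (S.measurable_pilotNormed p)
    (S.hasLaw_pilotNormed p) k
  simp only [Fintype.card_fin] at h
  have hv := (p.estVar_pos k).ne'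
  convert! h using 2 with ω
  rw [X_eq, mul_div_cancel_left₀ _ hv]

lemma ae_isUnit_gram (hKM : K ≤ M) :
    ∀ᵐ ω ∂μ, IsUnit ((S.Ghat p p.ℓ ω)ᴴ * S.Ghat p p.ℓ ω) := by
  have h := ae_linearIndependent (by simpa using hKM) (S.measurable_pilotNormed p)
    (S.hasLaw_pilotNormed p)
  filter_upwards [h] with ω hω
  refine isUnit_gram ?_
  have h1 := hω.units_smul fun k => Units.mk0
    ((p.gain p.ℓ k * Real.sqrt (p.pilotVar k) : ℝ) : ℂ) (by
      exact_mod_cast (mul_pos (p.gain_pos _ k) (Real.sqrt_pos.2 (p.pilotVar_pos k))).ne')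
  convert! h1 using 1
  ext k m
  rw [Ghat_eq_pilotNormed_mul, Matrix.mul_diagonal, mul_comm]
  rfl

lemma condLExp_zfOutput (hKM : K ≤ M) (i : Fin L) (d : Fin K → ℂ) (k : Fin K) :
    condLExp (S.estimateSigma p) μ (fun ω => ‖zfOutput d k
        (fun m j => S.Ghat p p.ℓ ω m j, fun m j => S.ξ p i ω m j, S.x i ω)‖ₑ ^ 2)
      =ᵐ[μ] fun ω => ENNReal.ofReal (‖d k‖ ^ 2
        + p.α i * ∑ m, ‖zf (fun m j => S.Ghat p p.ℓ ω m j) m k‖ ^ 2) := by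
  have h := condLExp_comap_of_indepFun (S.measurable_Ghat p p.ℓ)
    ((S.measurable_ξ p i).prodMk (S.measurable_data i)).aemeasurable (S.indepFun_Ghat_ξ_x p i)
    (F := fun q => ‖zfOutput d k q‖ₑ ^ 2) ((measurable_zfOutput d k).enorm.pow_const 2)
  filter_upwards [h, S.ae_isUnit_gram p hKM] with ω h1 h2
  exact h1.trans (S.lintegral_zfOutput p i d k h2)

/-- The SINR in terms of `X`. -/
theorem ae_sinr_eq (hKM : K ≤ M) (k : Fin K) :
    ∀ᵐ ω ∂μ, 0 < S.X p k ω ∧ S.sinr p k ω = S.X p k ω / (p.θ + p.η k * S.X p k ω) := by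
  -- The error of cell ℓ itself is the case `d = 0`; the interfering cells have `d` equal to the
  -- ratios of the β.
  have hterm1 : (fun ω => ‖S.detect p k ω (S.ξ p p.ℓ ω *ᵥ S.x p.ℓ ω)‖ₑ ^ 2)
      = fun ω => ‖zfOutput (fun _ => 0) k (fun m j => S.Ghat p p.ℓ ω m j,
        fun m j => S.ξ p p.ℓ ω m j, S.x p.ℓ ω)‖ₑ ^ 2 := by
    ext ω
    rw [detect_eq, zfOutput]
    simp only [Matrix.diagonal_zero, Matrix.mul_zero, add_zero]
    rfl
  have hterm2 : ∀ i, (fun ω => ‖S.detect p k ω (S.G p i ω *ᵥ S.x i ω)‖ₑ ^ 2)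
      = fun ω => ‖zfOutput (fun j => ((p.β i j / p.β p.ℓ j : ℝ) : ℂ)) k
        (fun m j => S.Ghat p p.ℓ ω m j, fun m j => S.ξ p i ω m j, S.x i ω)‖ₑ ^ 2 := by
    intro i
    ext ω
    rw [detect_eq, zfOutput]
    have hG : S.G p i ω = S.ξ p i ω + S.Ghat p p.ℓ ω * Matrix.diagonal fun j =>
        ((p.β i j / p.β p.ℓ j : ℝ) : ℂ) := by
      rw [← Ghat_eq_mul_diagonal, ξ, sub_add_cancel]
    rw [hG]
    rfl
  have hmeas : ∀ i, Measurable fun ω => ‖S.detect p k ω (S.G p i ω *ᵥ S.x i ω)‖ₑ ^ 2 := by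
    intro i
    rw [hterm2]
    exact ((measurable_zfOutput _ k).comp ((S.measurable_Ghat p p.ℓ).prodMk
      ((S.measurable_ξ p i).prodMk (S.measurable_data i)))).enorm.pow_const 2
  have h1 := S.condLExp_zfOutput p hKM p.ℓ (fun _ => 0) k
  rw [← hterm1] at h1
  have h2 : ∀ᵐ ω ∂μ, ∀ i, condLExp (S.estimateSigma p) μ
      (fun ω => ‖S.detect p k ω (S.G p i ω *ᵥ S.x i ω)‖ₑ ^ 2) ω
      = ENNReal.ofReal (‖((p.β i k / p.β p.ℓ k : ℝ) : ℂ)‖ ^ 2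
        + p.α i * ∑ m, ‖zf (fun m j => S.Ghat p p.ℓ ω m j) m k‖ ^ 2) := by
    refine ae_all_iff.2 fun i => ?_
    rw [hterm2]
    exact S.condLExp_zfOutput p hKM i _ k
  have h2s := condLExp_finsetSum (mΩ := S.estimateSigma p) (P := μ)
    (Finset.univ.erase p.ℓ) (X := fun i ω => ‖S.detect p k ω (S.G p i ω *ᵥ S.x i ω)‖ₑ ^ 2)
    (fun i => (hmeas i).aemeasurable)
  have h3 := condLExp_comap_of_indepFun (S.measurable_Ghat p p.ℓ)
    (measurable_pi_iff.2 S.measurable_n).aemeasurable (S.indepFun_Ghat_noise p)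
    (F := fun q => ‖((zf q.1)ᴴ *ᵥ q.2) k‖ₑ ^ 2 / ENNReal.ofReal p.P) (by
      have h2 : ∀ m k, Measurable fun q : (Fin M → Fin K → ℂ) × (Fin M → ℂ) =>
        star (zf q.1 m k) := fun m k => (measurable_star_zf m k).comp measurable_fst
      simp only [Matrix.mulVec, dotProduct, Matrix.conjTranspose_apply]
      fun_prop)
  filter_upwards [h1, h2, h2s, h3, S.ae_isUnit_gram p hKM] with ω h1 h2 h2s h3 hU
  -- This is ‖a_k‖², the k-th diagonal entry of the inverse Gram matrix, hence 1 / X.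
  set s : ℝ := ∑ m, ‖zf (fun m j => S.Ghat p p.ℓ ω m j) m k‖ ^ 2 with hs
  have hs0 : 0 < s := gram_inv_pos hU k
  have hX : S.X p k ω = 1 / s := by
    rw [X, gram_inv_apply_self hU k, Complex.ofReal_re]
    rfl
  refine ⟨by rw [hX]; positivity, ?_⟩
  have hn : ∫⁻ ω', ‖((zf fun m j => S.Ghat p p.ℓ ω m j)ᴴ *ᵥ S.n ω') k‖ₑ ^ 2
      / ENNReal.ofReal p.P ∂μ = ENNReal.ofReal (s / p.P) := by
    simp only [div_eq_mul_inv]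
    rw [lintegral_mul_const' _ _ (by simpa using p.P_pos), lintegral_zf_noise,
      ENNReal.ofReal_mul hs0.le, ENNReal.ofReal_inv_of_pos p.P_pos]
  have h3' : condLExp (S.estimateSigma p) μ
        (fun ω => ‖S.detect p k ω (S.n ω)‖ₑ ^ 2 / ENNReal.ofReal p.P) ω
      = ENNReal.ofReal (s / p.P) := by
    rw [← hn]
    exact h3
  have h2' : condLExp (S.estimateSigma p) μ (fun ω => ∑ i ∈ Finset.univ.erase p.ℓ,
        ‖S.detect p k ω (S.G p i ω *ᵥ S.x i ω)‖ₑ ^ 2) ω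
      = ENNReal.ofReal (p.η k + (∑ i ∈ Finset.univ.erase p.ℓ, p.α i) * s) := by
    have h4 : (fun ω => ∑ i ∈ Finset.univ.erase p.ℓ,
        ‖S.detect p k ω (S.G p i ω *ᵥ S.x i ω)‖ₑ ^ 2) = ∑ i ∈ Finset.univ.erase p.ℓ,
        fun ω => ‖S.detect p k ω (S.G p i ω *ᵥ S.x i ω)‖ₑ ^ 2 := by
      ext ω
      simp
    rw [h4, h2s, Finset.sum_apply, Finset.sum_congr rfl fun i _ => h2 i,
      ← ENNReal.ofReal_sum_of_nonneg, Finset.sum_add_distrib, ← Finset.sum_mul,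
      ← Params.η_eq_sum]
    intro i _
    have := p.α_nonneg i
    positivity
  have hα := p.α_nonneg p.ℓ
  have hη : 0 ≤ p.η k := by
    rw [Params.η_eq_sum]
    positivity
  have hαs : 0 ≤ ∑ i ∈ Finset.univ.erase p.ℓ, p.α i := Finset.sum_nonneg fun i _ => p.α_nonneg i
  have hP := p.P_pos
  rw [sinr, h1, h2', h3', ← ENNReal.ofReal_add (by positivity) (by positivity),
    ← ENNReal.ofReal_add (by positivity) (by positivity), ENNReal.toReal_inv,
    ENNReal.toReal_ofReal (by positivity), hX]
  have hθ : p.θ = p.α p.ℓ + ∑ i ∈ Finset.univ.erase p.ℓ, p.α i + 1 / p.P := by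
    rw [Params.θ, Finset.add_sum_erase _ _ (Finset.mem_univ p.ℓ)]
  -- The error powers of all cells and the noise combine to θ, leaving 1 / γ = η + θ / X.
  have h5 : ‖(0 : ℂ)‖ ^ 2 + p.α p.ℓ * s
      + (p.η k + (∑ i ∈ Finset.univ.erase p.ℓ, p.α i) * s) + s / p.P = p.η k + p.θ * s := by
    rw [hθ, norm_zero]
    ring
  rw [h5]
  have hθ0 := p.θ_pos
  field_simp
  ring

/-- The SINR as a function of the normalised `X`. -/
lemma ae_sinr_eq_div (hKM : K ≤ M) (k : Fin K) :
    ∀ᵐ ω ∂μ, S.sinr p k ω = (S.X p k ω / p.estVar k)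
      / (p.θnorm k + p.η k * (S.X p k ω / p.estVar k)) := by
  filter_upwards [S.ae_sinr_eq p hKM k] with ω hω
  have hv := p.estVar_pos k
  have hθ := p.θ_pos
  rw [hω.2, Params.θnorm_eq, mul_div_assoc', ← add_div, div_div_div_cancel_right₀ hv.ne']

theorem hasLaw_sinr (hL : 1 < L) (hKM : K ≤ M) (k : Fin K) :
    HasLaw (S.sinr p k) (volume.withDensity fun s => ENNReal.ofReal (p.sinrPDF k s)) μ := by
  have h := map_erlangMeasure_sinr (p.θnorm_pos k) (p.η_pos hL k) (M - K)
  have hφ : Measurable fun x : ℝ => x / (p.θnorm k + p.η k * x) := by fun_prop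
  have h1 : HasLaw (fun x : ℝ => x / (p.θnorm k + p.η k * x))
      (volume.withDensity fun s => ENNReal.ofReal (p.sinrPDF k s)) (erlangMeasure (M - K)) :=
    ⟨hφ.aemeasurable, h⟩
  exact (h1.comp (S.hasLaw_X_div p hKM k)).congr (S.ae_sinr_eq_div p hKM k)

/-- Instead of integrating the density, monotonicity of the SINR map turns each event into one about
the Erlang variable; outside [0, 1/η) the range of the map settles the value. -/
theorem measureReal_sinr_le (hL : 1 < L) (hKM : K ≤ M) (k : Fin K) (s : ℝ) :
    μ.real {ω | S.sinr p k ω ≤ s} = p.sinrCDF k s := by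
  have hθ := p.θnorm_pos k
  have hη := p.η_pos hL k
  have hT := S.hasLaw_X_div p hKM k
  have hpos := ae_pos_of_hasLaw_erlangMeasure hT
  have hsinr := S.ae_sinr_eq_div p hKM k
  unfold Params.sinrCDF
  split_ifs with h0 h1
  · have : μ {ω | S.sinr p k ω ≤ s} = 0 := by
      refine measure_mono_null (t := {ω | ¬ 0 < S.sinr p k ω}) (fun ω hω => ?_) ?_
      · exact not_lt.2 (le_trans hω h0.le)
      · refine ae_iff.1 ?_
        filter_upwards [hpos, hsinr] with ω h2 h3
        rw [h3]
        exact (sinrInv_sinr hθ hη h2).2.1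
    rw [measureReal_def, this, ENNReal.toReal_zero]
  · push Not at h0
    have h2 : ∀ᵐ ω ∂μ, S.sinr p k ω ≤ s ↔
        S.X p k ω / p.estVar k ≤ p.θnorm k * s / (1 - p.η k * s) := by
      filter_upwards [hpos, hsinr] with ω h2 h3
      rw [h3, sinr_le_iff hθ hη h2 h1]
    have h3 := one_sub_mul_pos hη h1
    have h4 : μ {ω | S.sinr p k ω ≤ s}
        = μ {ω | S.X p k ω / p.estVar k ≤ p.θnorm k * s / (1 - p.η k * s)} :=
      measure_congr (Filter.eventuallyEq_set.2 h2)
    rw [measureReal_def, h4, ← measureReal_def,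
      hT.measureReal_eq (p := fun x => x ≤ p.θnorm k * s / (1 - p.η k * s)) measurableSet_Iic]
    exact erlangMeasure_Iic (M - K) (by positivity)
  · push Not at h1
    have h2 : ∀ᵐ ω ∂μ, S.sinr p k ω ≤ s := by
      filter_upwards [hpos, hsinr] with ω h2 h3
      rw [h3]
      exact (sinrInv_sinr hθ hη h2).1.le.trans h1
    have h3 : μ {ω | S.sinr p k ω ≤ s} = μ Set.univ :=
      measure_congr (Filter.eventuallyEq_univ.2 h2)
    rw [measureReal_def, h3, measure_univ, ENNReal.toReal_one]

end Signals

end MassiveMIMO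

end

theorem proposition1 {L M K τ : ℕ} (hL : 1 < L) (hKM : K ≤ M)
    {Ω : Type*} [MeasurableSpace Ω] (μ : Measure Ω) [IsProbabilityMeasure μ]
    (p : MassiveMIMO.Params L M K τ) (S : MassiveMIMO.Signals L M K τ μ) (k : Fin K) :
    -- the channel estimates are the MMSE estimates given the received pilots
    (∀ i m j, μ[fun ω => S.G p i ω m j | S.pilotSigma p] =ᵐ[μ] fun ω => S.Ghat p i ω m j) ∧
    -- the error covariance is `E[ξ_i ξ_i†] = α_i I`
    (∀ i m m', ∫ ω, (S.ξ p i ω * (S.ξ p i ω)ᴴ) m m' ∂μ = if m = m' then (p.α i : ℂ) else 0) ∧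
    -- the SINR in terms of `X`
    (∀ᵐ ω ∂μ, 0 < S.X p k ω ∧ S.sinr p k ω = S.X p k ω / (p.θ + p.η k * S.X p k ω)) ∧
    -- the SINR has the claimed density
    HasLaw (S.sinr p k) (volume.withDensity fun s => ENNReal.ofReal (p.sinrPDF k s)) μ ∧
    -- and the claimed distribution function
    (∀ s : ℝ, μ.real {ω | S.sinr p k ω ≤ s} = p.sinrCDF k s) := by
  exact ⟨S.condExp_G p, S.integral_ξ_mul_conjTranspose p, S.ae_sinr_eq p hKM k,
    S.hasLaw_sinr p hL hKM k, S.measureReal_sinr_le p hL hKM k⟩
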